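/- Fix an order $p\ge 0$, a period $T\ge 1$, hyper-parameters $\nu,a,b^{(1)},b^{(2)}>0$, an integer $M\ge 0$ and $d>0$. A relative changepoint model is $\lambda=(\lambda_1,\dots,\lambda_m)$ with $0<\lambda_1<\dots<\lambda_m<1$; put $\lambda_0=0$, $\lambda_{m+1}=1$, and let $\Lambda$ be the set of those with $m\le M$ and $\lambda_r-\lambda_{r-1}\ge d$ for $1\le r\le m+1$. For a sample size $N$ put $\tau_0=1$, $\tau_r=\lfloor\lambda_rN\rfloor$ $(1\le r\le m)$, $\tau_{m+1}=N+1$, $N_r=\lfloor\lambda_rN\rfloor-\lfloor\lambda_{r-1}N\rfloor$; time $t$ is in regime $r$ if $\tau_{r-1}\le t<\tau_r$, and in season $v(t)=t-T\lfloor (t-1)/T\rfloor$. Let $A$ be the $N\times T$ matrix of season indicators and $D$ the $N\times m$ matrix of indicators of the regimes $2,\dots,m+1$ of $\lambda$. For each $N$ a set of documented times in $\{p+1,\dots,N\}$ is given; $N^{(2)}$ and $N^{(1)}=N-p-N^{(2)}$ are the numbers of documented and undocumented times, $m^{(2)}$ and $m^{(1)}=m-m^{(2)}$ the numbers of documented and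 undocumented changepoints $\tau_1,\dots,\tau_m$ of $\lambda$. Assume that either there are no documented times for any $N$, or both $N^{(1)}$ and $N^{(2)}$ are of exact order $N$. Data. Let $X_t=s_{v(t)}+\mu_{r^0(t)}+\epsilon_t$, $1\le t\le N$, where $r^0(t)$ is the regime of $t$ under a true model $\lambda^0\in\Lambda$, the seasonal means $s_1,\dots,s_T$ and the regime means ($\mu_1=0$, the others arbitrary) are real numbers, and $\epsilon_t=\sum_{j=1}^p\phi_j\epsilon_{t-j}+Z_t$ $(t\in\mathbb Z)$ is a causal AR$(p)$ process, i.e. $\epsilon_t=\sum_{j\ge0}\psi_jZ_{t-j}$ with $\sum_j|\psi_j|<\infty$, driven by iid $Z_t$ with mean $0$ and variance $\sigma^2>0$ (for example normal). Estimators. Given $\lambda\in\Lambda$, let $\epsilon^{\rm ols}=(I-\mathcal P_{[A|D]})X$, where $\mathcal P$ denotes the orthogonal projection onto a column space, $\hat\gamma(h)=N^{-1}\sum_{t=h+1}^N\epsilon_t^{\rm ols}\epsilon_{t-h}^{\rm ols}$, and let $\hat\phi=\hat\Gamma_p^{-1}\hat\gamma_p$ be the Yule–Walker estimator, with $\hat\Gamma_p=(\hat\gamma(|i-j|))_{i,j=1}^p$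 and $\hat\gamma_p=(\hat\gamma(1),\dots,\hat\gamma(p))'$. Let $\hat X,\hat A,\hat D$ have the rows $X_t-\sum_j\hat\phi_jX_{t-j}$, $A_t-\sum_j\hat\phi_jA_{t-j}$, $D_t-\sum_j\hat\phi_jD_{t-j}$ for $t=p+1,\dots,N$, and put $\hat B=I-\hat D(\hat D'\hat D+I_m/\nu)^{-1}\hat D'$, $$\hat\sigma^2=\tfrac1{N-p}\hat X'\{\hat B-\hat B\hat A(\hat A'\hat B\hat A)^{-1}\hat A'\hat B\}\hat X,\qquad \hat\sigma^2_{\nu=\infty}=\tfrac1{N-p}\hat X'(I-\mathcal P_{[\hat A|\hat D]})\hat X .$$ Define $$\mathrm{BMDL}_N(\lambda)=\tfrac{N-p}2\log\hat\sigma^2+\tfrac m2\log\nu+\tfrac12\log\bigl|\hat D'\hat D+\tfrac{I_m}{\nu}\bigr|-\sum_{k=1}^2\log\bigl\{\Gamma(a+m^{(k)})\,\Gamma(b^{(k)}+N^{(k)}-m^{(k)})\bigr\},$$ $$\mathrm{MDL}_N(\lambda)=\tfrac{N-p}2\log\hat\sigma^2_{\nu=\infty}+\tfrac12\sum_{r=2}^{m+1}\log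 N_r+\log(m+1)+(m+1)\log(N-p).$$ Theorem. There are real constants $c_N$, not depending on the candidate model $\lambda$, on the true model and its parameters, or on the data, such that for every $\lambda\in\Lambda$, as $N\to\infty$, $$\mathrm{BMDL}_N(\lambda)-\mathrm{MDL}_N(\lambda)-c_N=O_P(1).$$ -/

import Mathlib

open MeasureTheory ProbabilityTheory Filter Matrix
open scoped Asymptotics

noncomputable section

namespace Changepoint

/-- `Y N = O_P(1)` as `N → ∞`: the sequence is bounded in probability. -/
def IsBigOPOne {Ω : Type*} [MeasurableSpace Ω] (P : Measure Ω) (Y : ℕ → Ω → ℝ) : Prop :=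
  ∀ ε : ℝ, 0 < ε → ∃ K : ℝ, ∀ᶠ N in atTop, P {ω | K < |Y N ω|} ≤ ENNReal.ofReal ε

/-! ### The error process -/

/-- `ε` is a causal AR(p) process driven by the iid mean-zero noise `Z` of variance `σ ^ 2`:
it satisfies the AR recursion and is an absolutely summable one-sided moving average of `Z`.
The coefficient `φ j` stands for `φ_{j+1}`. -/
structure IsCausalAR {Ω : Type*} [MeasurableSpace Ω] (P : Measure Ω) {p : ℕ}
    (φ : Fin p → ℝ) (σ : ℝ) (Z ε : ℤ → Ω → ℝ) : Prop where
  indep : iIndepFun Z P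
  ident : ∀ t, IdentDistrib (Z t) (Z 0) P P
  memLp : MemLp (Z 0) 2 P
  mean_zero : ∫ ω, Z 0 ω ∂P = 0
  variance_eq : variance (Z 0) P = σ ^ 2
  recursion : ∀ t : ℤ, ∀ᵐ ω ∂P,
    ε t ω = ∑ j : Fin p, φ j * ε (t - ((j : ℤ) + 1)) ω + Z t ω
  causal : ∃ ψ : ℕ → ℝ, Summable (fun j => |ψ j|) ∧
    ∀ t : ℤ, ∀ᵐ ω ∂P, HasSum (fun j : ℕ => ψ j * Z (t - j) ω) (ε t ω)

/-! ### Relative changepoint configurations -/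

/-- A relative changepoint configuration `0 < λ_1 < ⋯ < λ_m < 1`; `loc r` is `λ_{r+1}`. -/
structure RelConfig where
  m : ℕ
  loc : Fin m → ℝ
  strictMono : StrictMono loc
  pos : ∀ r, 0 < loc r
  lt_one : ∀ r, loc r < 1

namespace RelConfig

/-- `λ_0 = 0`, `λ_1, …, λ_m`, `λ_{m+1} = 1` (and the value `1` beyond). -/
def ext (l : RelConfig) (r : ℕ) : ℝ :=
  if r = 0 then 0 else if h : r - 1 < l.m then l.loc ⟨r - 1, h⟩ else 1

/-- Changepoint times for sample size `N`: `τ_0 = 1`, `τ_r = ⌊λ_r N⌋` for `1 ≤ r ≤ m`,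
`τ_{m+1} = N + 1`. -/
def tau (l : RelConfig) (N r : ℕ) : ℕ :=
  if r = 0 then 1 else if r ≤ l.m then ⌊l.ext r * N⌋₊ else N + 1

/-- The regime length `N_r = ⌊λ_r N⌋ - ⌊λ_{r-1} N⌋`, for `1 ≤ r ≤ m + 1`. -/
def regimeLen (l : RelConfig) (N r : ℕ) : ℝ :=
  (⌊l.ext r * N⌋₊ : ℝ) - (⌊l.ext (r - 1) * N⌋₊ : ℝ)

/-- The number `m^{(2)}` of documented changepoints, `doc` being the set of documented times. -/
def mDoc (l : RelConfig) (N : ℕ) (doc : Finset ℕ) : ℕ :=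
  ((Finset.Icc 1 l.m).filter (fun r => l.tau N r ∈ doc)).card

/-- The number `m^{(1)}` of undocumented changepoints. -/
def mUndoc (l : RelConfig) (N : ℕ) (doc : Finset ℕ) : ℕ :=
  ((Finset.Icc 1 l.m).filter (fun r => l.tau N r ∉ doc)).card

end RelConfig

/-- The set `Λ` of configurations with at most `M` changepoints and relative spacings at
least `d`. -/
def Lam (M : ℕ) (d : ℝ) : Set RelConfig :=
  {l | l.m ≤ M ∧ ∀ r ∈ Finset.Icc 1 (l.m + 1), d ≤ l.ext r - l.ext (r - 1)}

/-- The number `N^{(2)}` of documented times in `{p+1, …, N}`. -/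
def nDoc (p N : ℕ) (doc : Finset ℕ) : ℕ :=
  ((Finset.Icc (p + 1) N).filter (fun t => t ∈ doc)).card

/-- The number `N^{(1)} = N - p - N^{(2)}` of undocumented times in `{p+1, …, N}`. -/
def nUndoc (p N : ℕ) (doc : Finset ℕ) : ℕ :=
  ((Finset.Icc (p + 1) N).filter (fun t => t ∉ doc)).card

/-! ### Design matrices (entry at time `t ≥ 1`) -/

/-- The season `v(t) = t - T ⌊(t-1)/T⌋ ∈ {1, …, T}` of the time `t ≥ 1`. -/
def season (T t : ℕ) : ℕ := t - T * ((t - 1) / T)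

/-- Seasonal indicator; the column `v : Fin T` belongs to season `v + 1`. -/
def seasonInd (T t : ℕ) (v : Fin T) : ℝ := if season T t = (v : ℕ) + 1 then 1 else 0

/-- Regime indicator; the column `r : Fin m` belongs to regime `r + 2`, which consists of the
times `t` with `τ_{r+1} ≤ t < τ_{r+2}`. -/
def regimeInd (l : RelConfig) (N t : ℕ) (r : Fin l.m) : ℝ :=
  if l.tau N (r + 1) ≤ t ∧ t < l.tau N (r + 2) then 1 else 0

/-- The observation `X_t` in a sample of size `N`: seasonal mean, plus the mean of the regime of
`t` under the true configuration (zero for the first regime, `μ r` for regime `r + 2`),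
plus the error. -/
def obs {Ω : Type*} {T : ℕ} (l0 : RelConfig) (s : Fin T → ℝ) (μ : Fin l0.m → ℝ)
    (ε : ℤ → Ω → ℝ) (N : ℕ) (ω : Ω) (t : ℕ) : ℝ :=
  ∑ v, seasonInd T t v * s v + ∑ r, regimeInd l0 N t r * μ r + ε t ω

/-! ### Least squares and Yule-Walker estimation -/

/-- The column space of a matrix. -/
def colSpace {n : ℕ} {ι : Type*} (A : Matrix (Fin n) ι ℝ) :
    Submodule ℝ (EuclideanSpace ℝ (Fin n)) :=
  Submodule.span ℝ (Set.range fun j => WithLp.toLp 2 fun i => A i j)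

/-- `(I - 𝒫_A) y`, with `𝒫_A` the orthogonal projection onto the column space of `A`. -/
def projResid {n : ℕ} {ι : Type*} (A : Matrix (Fin n) ι ℝ) (y : Fin n → ℝ) : Fin n → ℝ :=
  fun i => y i - (colSpace A).starProjection (WithLp.toLp 2 y) i

/-- The block matrix `[A_{1:N} | D_{1:N}]`; row `i` belongs to time `i + 1`. -/
def designFull (T : ℕ) (l : RelConfig) (N : ℕ) : Matrix (Fin N) (Fin T ⊕ Fin l.m) ℝ :=
  Matrix.of fun i => Sum.elim (seasonInd T (i + 1)) (regimeInd l N (i + 1))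

/-- Ordinary least squares residual at time `t ∈ {1, …, N}` (zero at other times) of the data
`x 1, …, x N`. -/
def olsResid (T : ℕ) (l : RelConfig) (N : ℕ) (x : ℕ → ℝ) (t : ℕ) : ℝ :=
  if h : 1 ≤ t ∧ t ≤ N then
    projResid (designFull T l N) (fun i => x (i + 1)) ⟨t - 1, by omega⟩
  else 0

/-- Sample autocovariance `γ̂(h)` of the residuals. -/
def gammaHat (T : ℕ) (l : RelConfig) (N : ℕ) (x : ℕ → ℝ) (h : ℕ) : ℝ :=
  (N : ℝ)⁻¹ * ∑ t ∈ Finset.Icc (h + 1) N, olsResid T l N x t * olsResid T l N x (t - h)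

/-- The Yule-Walker estimator `φ̂ = Γ̂_p⁻¹ γ̂_p`. -/
def phiHat (p T : ℕ) (l : RelConfig) (N : ℕ) (x : ℕ → ℝ) : Fin p → ℝ :=
  (Matrix.of fun i j : Fin p => gammaHat T l N x ((i : ℤ) - (j : ℤ)).natAbs)⁻¹ *ᵥ
    fun i => gammaHat T l N x (i + 1)

/-- `f_t - ∑_{j=1}^p φ_j f_{t-j}`, for `t > p`. -/
def arFilter {p : ℕ} (φ : Fin p → ℝ) (f : ℕ → ℝ) (t : ℕ) : ℝ :=
  f t - ∑ j : Fin p, φ j * f (t - (j + 1))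

/-- `X̂`; row `i` belongs to time `p + 1 + i`. -/
def XHat (p T : ℕ) (l : RelConfig) (N : ℕ) (x : ℕ → ℝ) : Fin (N - p) → ℝ :=
  fun i => arFilter (phiHat p T l N x) x (p + 1 + i)

/-- `Â`. -/
def AHat (p T : ℕ) (l : RelConfig) (N : ℕ) (x : ℕ → ℝ) : Matrix (Fin (N - p)) (Fin T) ℝ :=
  Matrix.of fun i v => arFilter (phiHat p T l N x) (fun t => seasonInd T t v) (p + 1 + i)

/-- `D̂`. -/
def DHat (p T : ℕ) (l : RelConfig) (N : ℕ) (x : ℕ → ℝ) : Matrix (Fin (N - p)) (Fin l.m) ℝ :=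
  Matrix.of fun i r => arFilter (phiHat p T l N x) (fun t => regimeInd l N t r) (p + 1 + i)

/-- `D̂' D̂ + I_m / ν`. -/
def ridgeGram (p T : ℕ) (ν : ℝ) (l : RelConfig) (N : ℕ) (x : ℕ → ℝ) :
    Matrix (Fin l.m) (Fin l.m) ℝ :=
  (DHat p T l N x)ᵀ * DHat p T l N x + ν⁻¹ • (1 : Matrix (Fin l.m) (Fin l.m) ℝ)

/-- `B̂ = I - D̂ (D̂' D̂ + I_m / ν)⁻¹ D̂'`. -/
def BHat (p T : ℕ) (ν : ℝ) (l : RelConfig) (N : ℕ) (x : ℕ → ℝ) :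
    Matrix (Fin (N - p)) (Fin (N - p)) ℝ :=
  1 - DHat p T l N x * (ridgeGram p T ν l N x)⁻¹ * (DHat p T l N x)ᵀ

/-- `σ̂² = (N - p)⁻¹ X̂' {B̂ - B̂ Â (Â' B̂ Â)⁻¹ Â' B̂} X̂`. -/
def sigmaSqHat (p T : ℕ) (ν : ℝ) (l : RelConfig) (N : ℕ) (x : ℕ → ℝ) : ℝ :=
  let X := XHat p T l N x
  let A := AHat p T l N x
  let B := BHat p T ν l N x
  ((N : ℝ) - p)⁻¹ * (X ⬝ᵥ ((B - B * A * (Aᵀ * B * A)⁻¹ * Aᵀ * B) *ᵥ X))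

/-- `σ̂²_{ν=∞} = (N - p)⁻¹ X̂' (I - 𝒫_{[Â|D̂]}) X̂`. -/
def sigmaSqHatInf (p T : ℕ) (l : RelConfig) (N : ℕ) (x : ℕ → ℝ) : ℝ :=
  ((N : ℝ) - p)⁻¹ * (XHat p T l N x ⬝ᵥ
    projResid (Matrix.fromCols (AHat p T l N x) (DHat p T l N x)) (XHat p T l N x))

/-! ### The two description lengths -/

/-- The Bayesian MDL of the configuration `l` for the data `x 1, …, x N`, with documented
times `doc`. -/
def BMDL (p T : ℕ) (ν a b₁ b₂ : ℝ) (doc : Finset ℕ) (l : RelConfig) (N : ℕ) (x : ℕ → ℝ) : ℝ :=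
  ((N : ℝ) - p) / 2 * Real.log (sigmaSqHat p T ν l N x) + (l.m : ℝ) / 2 * Real.log ν
    + 1 / 2 * Real.log (ridgeGram p T ν l N x).det
    - (Real.log (Real.Gamma (a + l.mUndoc N doc) *
          Real.Gamma (b₁ + nUndoc p N doc - l.mUndoc N doc))
      + Real.log (Real.Gamma (a + l.mDoc N doc) *
          Real.Gamma (b₂ + nDoc p N doc - l.mDoc N doc)))

/-- The automatic MDL of the configuration `l` for the data `x 1, …, x N`. -/
def MDL (p T : ℕ) (l : RelConfig) (N : ℕ) (x : ℕ → ℝ) : ℝ :=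
  ((N : ℝ) - p) / 2 * Real.log (sigmaSqHatInf p T l N x)
    + 1 / 2 * ∑ r ∈ Finset.Icc 2 (l.m + 1), Real.log (l.regimeLen N r)
    + Real.log ((l.m : ℝ) + 1) + ((l.m : ℝ) + 1) * Real.log ((N : ℝ) - p)

end Changepoint

end

noncomputable section

namespace Changepoint

/-! ### Stability of Yule-Walker filters -/

/-! The difference of the two criteria splits into `(N-p)/2` times the difference of the log
residual variances, half the difference between `log |D̂'D̂ + I/ν|` and `∑ log N_r`, the Gamma terms
against `(m+1) log (N-p)`, and constants depending only on `m` and `ν`. Randomness enters through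
two conditions only, collected in `GoodSample`: the sample second moment is at most `G`, and lag
combinations of the data, after removal of any candidate mean function, have energy at least `κ N
|a|²`. On such samples the comparison of variances and determinants is deterministic
(`goodSample_comparison`).

Consistency of the Yule-Walker estimator plays no role, which matters because the candidate model
may be wrong. It suffices that the estimated filter has bounded coefficients and does not nearly
annihilate a `T`-periodic sequence. This is a quantitative form of the classical stability of
Yule-Walker filters (`periodic_filter_lower_bound`, `yuleWalker_bounds`): the shifts of the
zero-padded residuals have an exactly Toeplitz Gram matrix, and the prediction error is orthogonal
to the lagged vectors. Inside a regime a mean function is `T`-periodic, and every regime has length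
of order `N`, so a filtered mean function has energy at least of order `N` times its squared
coefficients (`design_lower_bound`).

Variances: up to the factor `1/(N-p)`, `σ̂²` is the minimum of `|X̂ - Âs - D̂u|² + |u|²/ν` and
`σ̂²_{ν=∞}` the minimum without the penalty. The two minima therefore differ by at most `|u₀|²/ν`,
where `u₀` holds the unpenalised regime coefficients. The design bound keeps `|u₀|` bounded, the
unpenalised minimum is at least `κ N`, and so the logarithms differ by `O(1/N)`. Determinant: both
quantities are `m log N + O(1)`. Prior: `Γ(b+n-k)` equals `Γ(b+n) N^{-k}` up to bounded factors and
the two changepoint counts add up to `m`; the remaining `Γ(b+n)` and one `log N` do not see the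
model and form `c_N` (`prior_comparison`).

Samples are good with probability close to one. The upper condition is Markov's inequality. For the
lower one, the true autoregressive filter turns a lag combination of the centred data into the same
combination of the noise plus a vector in a nonrandom subspace of bounded dimension
(`lagVec_lagSum_lagSum`). The lagged noise vectors are nearly orthogonal with squared norm about `σ²
N`, and their projections onto such a subspace have bounded mean square. Second moments of the noise
are enough for all of this. -/

/-- The partial sums of a lag polynomial with coefficients `c`, acting on `f`. -/
def partialFilter {T : ℕ} (c : ℕ → ℝ) (f : ZMod T → ℝ) (j : ℕ) (u : ZMod T) : ℝ :=
  ∑ i ∈ Finset.range (j + 1), c i * f (u + j - i)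

lemma partialFilter_zero {T : ℕ} (c : ℕ → ℝ) (f : ZMod T → ℝ) (u : ZMod T) :
    partialFilter c f 0 u = c 0 * f u := by
  simp [partialFilter]

lemma partialFilter_succ {T : ℕ} (c : ℕ → ℝ) (f : ZMod T → ℝ) (j : ℕ) (u : ZMod T) :
    partialFilter c f (j + 1) u = partialFilter c f j (u + 1) + c (j + 1) * f u := by
  unfold partialFilter
  rw [Finset.sum_range_succ]
  congr 1
  · refine Finset.sum_congr rfl fun i _ => ?_
    push_cast
    congr 2
    ring
  · congr 2
    ring

lemma abs_partialFilter_le {T : ℕ} {c : ℕ → ℝ} {f : ZMod T → ℝ} {C F : ℝ} {p : ℕ}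
    (hC : ∀ i ≤ p, |c i| ≤ C) (hF : ∀ u, |f u| ≤ F) {j : ℕ} (hj : j ≤ p) (u : ZMod T) :
    |partialFilter c f j u| ≤ (p + 1) * C * F := by
  have hC0 : 0 ≤ C := (abs_nonneg _).trans (hC 0 (Nat.zero_le _))
  have hF0 : 0 ≤ F := (abs_nonneg _).trans (hF 0)
  calc |partialFilter c f j u| ≤ ∑ i ∈ Finset.range (j + 1), |c i * f (u + j - i)| :=
        Finset.abs_sum_le_sum_abs _ _
    _ ≤ ∑ i ∈ Finset.range (j + 1), C * F := by
        refine Finset.sum_le_sum fun i hi => ?_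
        rw [abs_mul]
        have : i ≤ p := by have := Finset.mem_range.1 hi; omega
        exact mul_le_mul (hC i this) (hF _) (abs_nonneg _) hC0
    _ = (j + 1) * (C * F) := by simp
    _ ≤ (p + 1) * (C * F) := by
        have : (j : ℝ) ≤ p := by exact_mod_cast hj
        gcongr
    _ = _ := by ring

section Stability

variable {E : Type*} [NormedAddCommGroup E] [InnerProductSpace ℝ E]

/-- The Toeplitz property says that replacing each `v j` by `v (j + 1)` is isometric on combinations
of `v 0, …, v (p - 1)`. -/
lemma norm_sq_sum_smul_shift {p : ℕ} {v : ℕ → E}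
    (hv : ∀ i < p, ∀ j < p, inner ℝ (v (i + 1)) (v (j + 1)) = inner ℝ (v i) (v j)) (w : ℕ → ℝ) :
    ‖∑ j ∈ Finset.range p, w j • v (j + 1)‖ ^ 2 = ‖∑ j ∈ Finset.range p, w j • v j‖ ^ 2 := by
  simp only [← real_inner_self_eq_norm_sq, sum_inner, inner_sum, real_inner_smul_left,
    real_inner_smul_right]
  refine Finset.sum_congr rfl fun i hi => Finset.sum_congr rfl fun j hj => ?_
  rw [hv j (Finset.mem_range.1 hj) i (Finset.mem_range.1 hi)]

/-- Summation by parts with `partialFilter_succ`: each partial sum at `u` is the previous one at `u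
+ 1` plus a multiple of `f u`. The multiples of `f u` assemble to the prediction error; the rest is
the same combination one step later, with shifted vectors. The boundary coefficient `partialFilter c
f p u` is the filter output, hence small when the filter nearly annihilates `f`. -/
lemma partialFilter_telescope {T : ℕ} (c : ℕ → ℝ) (f : ZMod T → ℝ) (v : ℕ → E) (u : ZMod T)
    (p : ℕ) :
    ∑ j ∈ Finset.range p, partialFilter c f j u • v j
      = f u • (∑ i ∈ Finset.range (p + 1), c i • v i)
        + (∑ j ∈ Finset.range p, partialFilter c f j (u + 1) • v (j + 1)
          - partialFilter c f p u • v p) := by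
  induction p with
  | zero => simp [partialFilter_zero, smul_smul, mul_comm]
  | succ p ih =>
    rw [Finset.sum_range_succ, ih, Finset.sum_range_succ _ (p + 1),
      Finset.sum_range_succ (fun j => partialFilter c f j (u + 1) • v (j + 1)) p,
      partialFilter_succ, add_smul, smul_add, smul_smul, mul_comm (f u)]
    abel

/-- If the Gram matrix of `v 0, …, v p` is Toeplitz and `∑ c i • v i`, with `c 0 = 1`, is
orthogonal to `v 1, …, v p`, then the lag polynomial with coefficients `c` is bounded below on
periodic sequences. -/
theorem periodic_filter_lower_bound {T p : ℕ} [NeZero T] {v : ℕ → E} {c : ℕ → ℝ} {g C : ℝ}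
    (hv : ∀ i < p, ∀ j < p, inner ℝ (v (i + 1)) (v (j + 1)) = inner ℝ (v i) (v j))
    (hc0 : c 0 = 1) (hC : ∀ i ≤ p, |c i| ≤ C) (hg : ∀ i ≤ p, ‖v i‖ ^ 2 ≤ g)
    (horth : ∀ j, 1 ≤ j → j ≤ p →
      inner ℝ (∑ i ∈ Finset.range (p + 1), c i • v i) (v j) = 0)
    (f : ZMod T → ℝ) :
    (‖∑ i ∈ Finset.range (p + 1), c i • v i‖ ^ 2) ^ 2 * ∑ u, f u ^ 2
      ≤ (2 * g * (p + 1) ^ 2 * C) ^ 2 * T *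
        ∑ u : ZMod T, (∑ i ∈ Finset.range (p + 1), c i * f (u - i)) ^ 2 := by
  have hC1 : 1 ≤ C := by simpa [hc0] using hC 0 (Nat.zero_le _)
  have hg0 : 0 ≤ g := (sq_nonneg _).trans (hg 0 (Nat.zero_le _))
  have hT1 : (1 : ℝ) ≤ T := by exact_mod_cast NeZero.one_le
  -- For `p = 0` the filter is the identity; the main argument needs `p ≥ 1` to have the prediction
  -- error orthogonal to `v p`.
  rcases Nat.eq_zero_or_pos p with rfl | hp
  · simp only [zero_add, Finset.range_one, Finset.sum_singleton, hc0, one_smul, one_mul,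
      Nat.cast_zero, sub_zero]
    have h1 := hg 0 le_rfl
    have hs : 0 ≤ ∑ u, f u ^ 2 := Finset.sum_nonneg fun _ _ => sq_nonneg _
    refine mul_le_mul_of_nonneg_right ?_ hs
    calc (‖v 0‖ ^ 2) ^ 2 ≤ g ^ 2 := by gcongr
      _ ≤ (2 * g * 1 ^ 2 * C) ^ 2 * 1 := by
        rw [mul_one]; gcongr; nlinarith
      _ ≤ _ := by gcongr
  set Y := ∑ i ∈ Finset.range (p + 1), c i • v i with hY
  set F := Real.sqrt (∑ u, f u ^ 2) with hFdef
  have hFsq : F ^ 2 = ∑ u, f u ^ 2 := Real.sq_sqrt (Finset.sum_nonneg fun _ _ => sq_nonneg _)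
  have hF0 : 0 ≤ F := Real.sqrt_nonneg _
  have hF : ∀ u, |f u| ≤ F := fun u => by
    apply Real.abs_le_sqrt
    exact Finset.single_le_sum (f := fun u => f u ^ 2) (fun _ _ => sq_nonneg _) (Finset.mem_univ u)
  set W := partialFilter c f with hW
  have hWle : ∀ j ≤ p, ∀ u, |W j u| ≤ (p + 1) * C * F := fun j hj u =>
    abs_partialFilter_le hC hF hj u
  set U : ZMod T → E := fun u => ∑ j ∈ Finset.range p, W j u • v j
  set V : ZMod T → E := fun u => ∑ j ∈ Finset.range p, W j u • v (j + 1)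
  -- Over a full period the energies of `U` and of the advanced `V` agree, so they cancel once
  -- `hstep` is summed; only `f` and the filter output survive.
  have hUV : ∑ u, ‖V (u + 1)‖ ^ 2 = ∑ u, ‖U u‖ ^ 2 := by
    refine (Equiv.sum_comp (Equiv.addRight (1 : ZMod T)) (fun u => ‖V u‖ ^ 2)).trans ?_
    exact Finset.sum_congr rfl fun u _ => norm_sq_sum_smul_shift hv _
  have hYv : ∀ j < p, inner ℝ Y (v (j + 1)) = 0 := fun j hj => horth _ (by omega) (by omega)
  have hYV : ∀ u, inner ℝ Y (V u) = 0 := fun u => by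
    simp only [V, inner_sum, real_inner_smul_right]
    exact Finset.sum_eq_zero fun j hj => by rw [hYv j (Finset.mem_range.1 hj), mul_zero]
  have hYp : inner ℝ Y (v p) = 0 := horth p hp le_rfl
  have hvv : ∀ i ≤ p, ∀ j ≤ p, |inner ℝ (v i) (v j)| ≤ g := fun i hi j hj => by
    refine (abs_real_inner_le_norm _ _).trans ?_
    nlinarith [hg i hi, hg j hj, sq_nonneg (‖v i‖ - ‖v j‖)]
  -- Pythagoras in the telescoped identity: the prediction error is orthogonal to both `V (u + 1)`
  -- and `v p`. The square of the boundary term is dropped and its cross term is bounded linearly in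
  -- the filter output.
  have hstep : ∀ u, f u ^ 2 * ‖Y‖ ^ 2 + ‖V (u + 1)‖ ^ 2
      ≤ ‖U u‖ ^ 2 + 2 * (|W p u| * (p * ((p + 1) * C * F * g))) := fun u => by
    have hU : U u = f u • Y + (V (u + 1) - W p u • v p) := partialFilter_telescope c f v u p
    have h0 : inner ℝ (f u • Y) (V (u + 1) - W p u • v p) = 0 := by
      rw [real_inner_smul_left, inner_sub_right, hYV, real_inner_smul_right, hYp]; simp
    have hin : |inner ℝ (V (u + 1)) (v p)| ≤ p * ((p + 1) * C * F * g) := by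
      simp only [V, sum_inner, real_inner_smul_left]
      calc _ ≤ ∑ j ∈ Finset.range p, |W j (u + 1) * inner ℝ (v (j + 1)) (v p)| :=
            Finset.abs_sum_le_sum_abs _ _
        _ ≤ ∑ j ∈ Finset.range p, (p + 1) * C * F * g := by
            refine Finset.sum_le_sum fun j hj => ?_
            have hj := Finset.mem_range.1 hj
            rw [abs_mul]
            exact mul_le_mul (hWle j hj.le _) (hvv _ (by omega) _ le_rfl) (abs_nonneg _)
              (by positivity)
        _ = _ := by simp
    have h1 : ‖U u‖ ^ 2 = f u ^ 2 * ‖Y‖ ^ 2 + (‖V (u + 1)‖ ^ 2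
        - 2 * (W p u * inner ℝ (V (u + 1)) (v p)) + ‖W p u • v p‖ ^ 2) := by
      rw [hU, norm_add_sq_real, h0, norm_sub_sq_real, norm_smul, mul_pow, Real.norm_eq_abs, sq_abs,
        real_inner_smul_right]
      ring
    have h2 : W p u * inner ℝ (V (u + 1)) (v p) ≤ |W p u| * (p * ((p + 1) * C * F * g)) :=
      (le_abs_self _).trans (by rw [abs_mul]; gcongr)
    nlinarith [sq_nonneg ‖W p u • v p‖]
  have hsum := Finset.sum_le_sum fun u (_ : u ∈ Finset.univ) => hstep u
  rw [Finset.sum_add_distrib, Finset.sum_add_distrib, hUV, ← Finset.sum_mul, ← Finset.mul_sum,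
    ← Finset.sum_mul, ← hFsq] at hsum
  set S := ∑ u, |W p u| with hS
  have hS0 : 0 ≤ S := Finset.sum_nonneg fun _ _ => abs_nonneg _
  have hmain : F * (F * ‖Y‖ ^ 2) ≤ F * (2 * g * (p + 1) ^ 2 * C * S) := by
    have : S * (p * ((p + 1) * C * F * g)) ≤ S * ((p + 1) * ((p + 1) * C * F * g)) := by
      gcongr; linarith
    nlinarith
  -- `W p u` is the filter output at `u + p`; translating the index and applying Cauchy-Schwarz over
  -- the period produces the factor `T`.
  have hWS : S ^ 2 ≤ T * ∑ u : ZMod T, (∑ i ∈ Finset.range (p + 1), c i * f (u - i)) ^ 2 := by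
    have h1 := sq_sum_le_card_mul_sum_sq (s := (Finset.univ : Finset (ZMod T)))
      (f := fun u => |W p u|)
    simp only [Finset.card_univ, ZMod.card, sq_abs] at h1
    refine h1.trans (le_of_eq ?_)
    congr 1
    rw [← Equiv.sum_comp (Equiv.addRight (p : ZMod T))
      (fun u => (∑ i ∈ Finset.range (p + 1), c i * f (u - i)) ^ 2)]
    rfl
  have hroot : F * ‖Y‖ ^ 2 ≤ 2 * g * (p + 1) ^ 2 * C * S := by
    rcases hF0.eq_or_lt with h | h
    · rw [← h, zero_mul]; positivity
    · exact le_of_mul_le_mul_left hmain h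
  calc (‖Y‖ ^ 2) ^ 2 * ∑ u, f u ^ 2 = (F * ‖Y‖ ^ 2) ^ 2 := by rw [← hFsq]; ring
    _ ≤ (2 * g * (p + 1) ^ 2 * C * S) ^ 2 := by gcongr
    _ = (2 * g * (p + 1) ^ 2 * C) ^ 2 * S ^ 2 := by ring
    _ ≤ (2 * g * (p + 1) ^ 2 * C) ^ 2 *
        (T * ∑ u : ZMod T, (∑ i ∈ Finset.range (p + 1), c i * f (u - i)) ^ 2) := by gcongr
    _ = _ := by ring

end Stability

/-! ### Least squares and ridge regression -/

lemma exists_projResid_eq {n : ℕ} {ι : Type*} [Fintype ι] (A : Matrix (Fin n) ι ℝ)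
    (y : Fin n → ℝ) :
    ∃ w : ι → ℝ, projResid A y = y - A *ᵥ w ∧ ∀ z : ι → ℝ, projResid A y ⬝ᵥ (A *ᵥ z) = 0 := by
  have hmem := (colSpace A).starProjection_apply_mem (WithLp.toLp 2 y)
  have key : ∀ w : ι → ℝ, (∑ j, w j • WithLp.toLp 2 fun i => A i j : EuclideanSpace ℝ (Fin n))
      = WithLp.toLp 2 (A *ᵥ w) := fun w => by
    ext i
    simp [Matrix.mulVec, dotProduct, mul_comm]
  obtain ⟨w, hw⟩ := (Submodule.mem_span_range_iff_exists_fun ℝ).1 hmem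
  rw [key] at hw
  have hres : projResid A y = y - A *ᵥ w := by
    ext i
    simp [projResid, ← hw]
  refine ⟨w, hres, fun z => ?_⟩
  have hz : WithLp.toLp 2 (A *ᵥ z) ∈ colSpace A := by
    rw [← key]
    exact (Submodule.mem_span_range_iff_exists_fun ℝ).2 ⟨z, rfl⟩
  have h := (colSpace A).starProjection_inner_eq_zero (WithLp.toLp 2 y) _ hz
  rw [← hw] at h
  rw [hres]
  simpa [EuclideanSpace.inner_eq_star_dotProduct, dotProduct_comm, ← WithLp.toLp_sub] using h

/-- Least squares: a coefficient vector realising the residual, with the minimality property. -/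
lemma exists_leastSquares {n : ℕ} {ι : Type*} [Fintype ι] (A : Matrix (Fin n) ι ℝ)
    (y : Fin n → ℝ) :
    ∃ w : ι → ℝ, projResid A y = y - A *ᵥ w ∧
      y ⬝ᵥ projResid A y = (y - A *ᵥ w) ⬝ᵥ (y - A *ᵥ w) ∧
      ∀ z : ι → ℝ, y ⬝ᵥ projResid A y ≤ (y - A *ᵥ z) ⬝ᵥ (y - A *ᵥ z) := by
  obtain ⟨w, hw, ho⟩ := exists_projResid_eq A y
  have h1 : y ⬝ᵥ projResid A y = projResid A y ⬝ᵥ projResid A y := by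
    have hy : y = projResid A y + A *ᵥ w := by rw [hw]; simp
    conv_lhs => rw [hy]
    rw [add_dotProduct, dotProduct_comm (A *ᵥ w)]
    have := ho w
    rw [← hy, this, add_zero]
  refine ⟨w, hw, by rw [h1, hw], fun z => ?_⟩
  have hz : y - A *ᵥ z = projResid A y + A *ᵥ (w - z) := by
    rw [hw, mulVec_sub]; abel
  rw [h1, hz]
  generalize hr : A *ᵥ (w - z) = q
  have h2 := ho (w - z)
  rw [hr] at h2
  have h3 : 0 ≤ q ⬝ᵥ q := by
    simpa using dotProduct_star_self_nonneg q
  rw [add_dotProduct, dotProduct_add, dotProduct_add, dotProduct_comm q, h2]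
  linarith

section Ridge

variable {n m k : Type*} [Fintype n] [Fintype m] [Fintype k] [DecidableEq m]

/-- The ridge Gram matrix `D' D + I / ν`. -/
abbrev ridge (D : Matrix n m ℝ) (ν : ℝ) : Matrix m m ℝ := Dᵀ * D + ν⁻¹ • (1 : Matrix m m ℝ)

/-- The matrix `I - D (D' D + I / ν)⁻¹ D'`. -/
abbrev ridgeResid [DecidableEq n] (D : Matrix n m ℝ) (ν : ℝ) : Matrix n n ℝ := 1 - D * (ridge D ν)⁻¹ * Dᵀ

lemma dotProduct_ridge (D : Matrix n m ℝ) (ν : ℝ) (u : m → ℝ) :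
    u ⬝ᵥ (ridge D ν *ᵥ u) = (D *ᵥ u) ⬝ᵥ (D *ᵥ u) + ν⁻¹ * (u ⬝ᵥ u) := by
  rw [add_mulVec, dotProduct_add, smul_mulVec, one_mulVec, dotProduct_smul, smul_eq_mul,
    ← mulVec_mulVec, dotProduct_mulVec, vecMul_transpose]

lemma ridge_posDef (D : Matrix n m ℝ) {ν : ℝ} (hν : 0 < ν) : (ridge D ν).PosDef := by
  refine Matrix.PosDef.posSemidef_add ?_ ?_
  · simpa using Matrix.posSemidef_conjTranspose_mul_self D
  · exact Matrix.PosDef.one.smul (inv_pos.2 hν)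

lemma ridge_transpose {m : Type*} [DecidableEq m] (D : Matrix n m ℝ) (ν : ℝ) : (ridge D ν)ᵀ = ridge D ν := by
  simp [ridge, transpose_add, transpose_mul]

lemma ridgeResid_transpose [DecidableEq n] (D : Matrix n m ℝ) (ν : ℝ) :
    (ridgeResid D ν)ᵀ = ridgeResid D ν := by
  simp [ridgeResid, transpose_sub, transpose_mul, transpose_nonsing_inv,
    Matrix.mul_assoc]

/-- The penalised sum of squares, completed to a square. -/
lemma ridge_completion [DecidableEq n] (D : Matrix n m ℝ) {ν : ℝ} (hν : 0 < ν) (y : n → ℝ) (u : m → ℝ) :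
    (y - D *ᵥ u) ⬝ᵥ (y - D *ᵥ u) + ν⁻¹ * (u ⬝ᵥ u)
      = y ⬝ᵥ (ridgeResid D ν *ᵥ y)
        + (u - (ridge D ν)⁻¹ *ᵥ (Dᵀ *ᵥ y)) ⬝ᵥ
          (ridge D ν *ᵥ (u - (ridge D ν)⁻¹ *ᵥ (Dᵀ *ᵥ y))) := by
  have hR := ridge_posDef D hν
  have hdet : IsUnit (ridge D ν).det := (Matrix.isUnit_iff_isUnit_det _).1 hR.isUnit
  set R := ridge D ν with hRdef
  set w := R⁻¹ *ᵥ (Dᵀ *ᵥ y) with hw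
  have hRw : R *ᵥ w = Dᵀ *ᵥ y := by
    rw [hw, mulVec_mulVec, Matrix.mul_nonsing_inv _ hdet, one_mulVec]
  have hRsymm : ∀ a b : m → ℝ, a ⬝ᵥ (R *ᵥ b) = b ⬝ᵥ (R *ᵥ a) := fun a b => by
    rw [dotProduct_mulVec, ← mulVec_transpose, hRdef, ridge_transpose, dotProduct_comm]
  have hyD : ∀ a : m → ℝ, y ⬝ᵥ (D *ᵥ a) = a ⬝ᵥ (R *ᵥ w) := fun a => by
    rw [hRw, dotProduct_mulVec, ← mulVec_transpose, dotProduct_comm]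
  have hB : y ⬝ᵥ (ridgeResid D ν *ᵥ y) = y ⬝ᵥ y - w ⬝ᵥ (R *ᵥ w) := by
    rw [ridgeResid, sub_mulVec, one_mulVec, dotProduct_sub, ← mulVec_mulVec, ← mulVec_mulVec,
      ← hRdef, ← hw, hyD]
  have hq := dotProduct_ridge D ν u
  rw [← hRdef] at hq
  rw [hB, mulVec_sub, sub_dotProduct, dotProduct_sub, dotProduct_sub, sub_dotProduct,
    dotProduct_sub, dotProduct_sub, dotProduct_comm (D *ᵥ u) y, hyD, hq, hRsymm w u]
  ring

lemma ridge_quadForm_nonneg (D : Matrix n m ℝ) {ν : ℝ} (hν : 0 < ν) (u : m → ℝ) :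
    0 ≤ u ⬝ᵥ (ridge D ν *ᵥ u) := by
  simpa using (ridge_posDef D hν).posSemidef.dotProduct_mulVec_nonneg u

lemma ridgeResid_quadForm_le [DecidableEq n] (D : Matrix n m ℝ) {ν : ℝ} (hν : 0 < ν) (y : n → ℝ) (u : m → ℝ) :
    y ⬝ᵥ (ridgeResid D ν *ᵥ y) ≤ (y - D *ᵥ u) ⬝ᵥ (y - D *ᵥ u) + ν⁻¹ * (u ⬝ᵥ u) := by
  rw [ridge_completion D hν]
  linarith [ridge_quadForm_nonneg D hν (u - (ridge D ν)⁻¹ *ᵥ (Dᵀ *ᵥ y))]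

lemma exists_ridgeResid_quadForm_eq [DecidableEq n] (D : Matrix n m ℝ) {ν : ℝ} (hν : 0 < ν) (y : n → ℝ) :
    ∃ u : m → ℝ,
      y ⬝ᵥ (ridgeResid D ν *ᵥ y) = (y - D *ᵥ u) ⬝ᵥ (y - D *ᵥ u) + ν⁻¹ * (u ⬝ᵥ u) :=
  ⟨(ridge D ν)⁻¹ *ᵥ (Dᵀ *ᵥ y), by rw [ridge_completion D hν]; simp⟩

/-- The form is an attained penalised sum of squares: if it vanished, the penalty would force `u =
0`, and the residual would then be `y` itself. -/
lemma ridgeResid_posDef [DecidableEq n] (D : Matrix n m ℝ) {ν : ℝ} (hν : 0 < ν) : (ridgeResid D ν).PosDef := by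
  refine Matrix.PosDef.of_dotProduct_mulVec_pos ?_ fun y hy => ?_
  · rw [Matrix.IsHermitian, conjTranspose_eq_transpose_of_trivial, ridgeResid_transpose]
  · obtain ⟨u, hu⟩ := exists_ridgeResid_quadForm_eq D hν y
    have h1 : 0 ≤ (y - D *ᵥ u) ⬝ᵥ (y - D *ᵥ u) := by
      simpa using dotProduct_star_self_nonneg (y - D *ᵥ u)
    have hν' := inv_pos.2 hν
    rw [star_trivial, hu]
    by_cases h : u = 0
    · subst h
      simp only [mulVec_zero, sub_zero, dotProduct_zero, mul_zero, add_zero]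
      simpa using (dotProduct_star_self_pos_iff (v := y)).2 hy
    · have h2 : 0 < u ⬝ᵥ u := by simpa using (dotProduct_star_self_pos_iff (v := u)).2 h
      have := mul_pos hν' h2
      linarith

/-- The generalised least squares residual form lies between the ordinary residual sum of squares
and its penalised version. -/
lemma gls_quadForm_bounds [DecidableEq n] [DecidableEq k] (A : Matrix n k ℝ) (D : Matrix n m ℝ) {ν : ℝ} (hν : 0 < ν)
    (hA : ∀ s : k → ℝ, A *ᵥ s = 0 → s = 0) (X : n → ℝ) :
    let B := ridgeResid D ν
    let q := X ⬝ᵥ ((B - B * A * (Aᵀ * B * A)⁻¹ * Aᵀ * B) *ᵥ X)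
    (∃ (s : k → ℝ) (u : m → ℝ),
      (X - A *ᵥ s - D *ᵥ u) ⬝ᵥ (X - A *ᵥ s - D *ᵥ u) ≤ q) ∧
    ∀ (s : k → ℝ) (u : m → ℝ),
      q ≤ (X - A *ᵥ s - D *ᵥ u) ⬝ᵥ (X - A *ᵥ s - D *ᵥ u) + ν⁻¹ * (u ⬝ᵥ u) := by
  intro B q
  have hBpos : B.PosDef := ridgeResid_posDef D hν
  have hBt : Bᵀ = B := ridgeResid_transpose D ν
  have hH : (Aᵀ * B * A).PosDef := by
    have := hBpos.conjTranspose_mul_mul_same (B := A) (fun s t hst => by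
      have : A *ᵥ (s - t) = 0 := by rw [mulVec_sub]; exact sub_eq_zero.2 hst
      exact sub_eq_zero.1 (hA _ this))
    simpa using this
  set H := Aᵀ * B * A with hHdef
  have hdet : IsUnit H.det := (Matrix.isUnit_iff_isUnit_det _).1 hH.isUnit
  set s₀ := H⁻¹ *ᵥ (Aᵀ *ᵥ (B *ᵥ X)) with hs₀
  have hHs : H *ᵥ s₀ = Aᵀ *ᵥ (B *ᵥ X) := by
    rw [hs₀, mulVec_mulVec, Matrix.mul_nonsing_inv _ hdet, one_mulVec]
  have hBsymm : ∀ a b : n → ℝ, a ⬝ᵥ (B *ᵥ b) = b ⬝ᵥ (B *ᵥ a) := fun a b => by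
    rw [dotProduct_mulVec, ← mulVec_transpose, hBt, dotProduct_comm]
  have hHt : Hᵀ = H := by simp [hHdef, transpose_mul, hBt, Matrix.mul_assoc]
  have hHsymm : ∀ a b : k → ℝ, a ⬝ᵥ (H *ᵥ b) = b ⬝ᵥ (H *ᵥ a) := fun a b => by
    rw [dotProduct_mulVec, ← mulVec_transpose, hHt, dotProduct_comm]
  have hXA : ∀ s : k → ℝ, X ⬝ᵥ (B *ᵥ (A *ᵥ s)) = s ⬝ᵥ (H *ᵥ s₀) := fun s => by
    rw [hBsymm, hHs, dotProduct_mulVec s Aᵀ, vecMul_transpose]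
  have hAA : ∀ s : k → ℝ, (A *ᵥ s) ⬝ᵥ (B *ᵥ (A *ᵥ s)) = s ⬝ᵥ (H *ᵥ s) := fun s => by
    rw [hHdef, ← mulVec_mulVec, ← mulVec_mulVec, dotProduct_mulVec s Aᵀ, vecMul_transpose]
  -- `s₀` is the generalised least squares solution, and `q` is the value of the `B`-form at its
  -- residual; `hexp` completes the square in `s` around it.
  have hq : q = X ⬝ᵥ (B *ᵥ X) - s₀ ⬝ᵥ (H *ᵥ s₀) := by
    have : (B * A * H⁻¹ * Aᵀ * B) *ᵥ X = B *ᵥ (A *ᵥ s₀) := by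
      simp only [hs₀, mulVec_mulVec, Matrix.mul_assoc]
    change X ⬝ᵥ ((B - B * A * H⁻¹ * Aᵀ * B) *ᵥ X) = _
    rw [sub_mulVec, dotProduct_sub, this, hXA]
  have hexp : ∀ s : k → ℝ, (X - A *ᵥ s) ⬝ᵥ (B *ᵥ (X - A *ᵥ s))
      = q + (s - s₀) ⬝ᵥ (H *ᵥ (s - s₀)) := fun s => by
    rw [hq, mulVec_sub, sub_dotProduct, dotProduct_sub, dotProduct_sub, mulVec_sub,
      sub_dotProduct, dotProduct_sub, dotProduct_sub, hBsymm (A *ᵥ s) X, hXA, hAA, hHsymm s₀ s]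
    ring
  constructor
  -- With `s = s₀` and the ridge minimiser `u`, the penalised sum of squares equals `q`; discarding
  -- the penalty gives the bound.
  · obtain ⟨u, hu⟩ := exists_ridgeResid_quadForm_eq D hν (X - A *ᵥ s₀)
    refine ⟨s₀, u, ?_⟩
    have h1 := hexp s₀
    rw [sub_self, zero_dotProduct, add_zero, show B = ridgeResid D ν from rfl, hu] at h1
    have h2 : 0 ≤ u ⬝ᵥ u := by simpa using dotProduct_star_self_nonneg u
    have h3 : 0 ≤ ν⁻¹ * (u ⬝ᵥ u) := mul_nonneg (inv_pos.2 hν).le h2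
    linarith
  · intro s u
    have h1 := hexp s
    have h2 : 0 ≤ (s - s₀) ⬝ᵥ (H *ᵥ (s - s₀)) := by
      simpa using hH.posSemidef.dotProduct_mulVec_nonneg (s - s₀)
    have h3 := ridgeResid_quadForm_le D hν (X - A *ᵥ s) u
    linarith

end Ridge

/-! ### Well-behaved samples -/

/-- The mean function with seasonal means `s` and regime means `μ`. -/
def fitted (T : ℕ) (l : RelConfig) (N : ℕ) (s : Fin T → ℝ) (μ : Fin l.m → ℝ) (t : ℕ) : ℝ :=
  ∑ v, seasonInd T t v * s v + ∑ r, regimeInd l N t r * μ r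

/-- `∑_{i ≤ p} a_i f_{t-i}`. -/
def lagSum (p : ℕ) (a : ℕ → ℝ) (f : ℕ → ℝ) (t : ℕ) : ℝ :=
  ∑ i ∈ Finset.range (p + 1), a i * f (t - i)

/-- The sample has second moment at most `G`, and after removal of any mean function of the
configuration `l` its lag combinations are nondegenerate with constant `κ`. -/
structure GoodSample (p T : ℕ) (l : RelConfig) (N : ℕ) (x : ℕ → ℝ) (κ G : ℝ) : Prop where
  upper : ∑ t ∈ Finset.Icc 1 N, x t ^ 2 ≤ G * N
  lower : ∀ (a : ℕ → ℝ) (s : Fin T → ℝ) (μ : Fin l.m → ℝ),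
    κ * N * ∑ i ∈ Finset.range (p + 1), a i ^ 2 ≤
      ∑ t ∈ Finset.Icc (p + 1) N, lagSum p a (fun t => x t - fitted T l N s μ t) t ^ 2

/-- The coefficients `1, -φ_1, …, -φ_p` of the autoregressive filter. -/
def arCoeff {p : ℕ} (φ : Fin p → ℝ) : ℕ → ℝ
  | 0 => 1
  | i + 1 => if h : i < p then -φ ⟨i, h⟩ else 0

lemma sum_range_arCoeff {p : ℕ} (φ : Fin p → ℝ) {E : Type*} [AddCommGroup E] [Module ℝ E]
    (v : ℕ → E) :
    ∑ i ∈ Finset.range (p + 1), arCoeff φ i • v i = v 0 - ∑ j : Fin p, φ j • v (j + 1) := by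
  rw [Finset.sum_range_succ', Finset.sum_range]
  simp [arCoeff, sub_eq_neg_add]

lemma arFilter_eq_lagSum {p : ℕ} (φ : Fin p → ℝ) (f : ℕ → ℝ) (t : ℕ) :
    arFilter φ f t = lagSum p (arCoeff φ) f t := by
  have := sum_range_arCoeff φ (fun i => f (t - i))
  simp only [smul_eq_mul] at this
  rw [lagSum, this, arFilter, Nat.sub_zero]

/-- Cauchy-Schwarz over the `p + 1` lags; starting `p` times after `q` keeps every lagged time in
the range on the right. The offset `q = p` serves for a filter applied to an already lagged
combination. -/
lemma sum_lagSum_sq_le_offset {p N : ℕ} {a : ℕ → ℝ} {C : ℝ} (hC : ∀ i ≤ p, |a i| ≤ C)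
    (f : ℕ → ℝ) (q : ℕ) :
    ∑ t ∈ Finset.Icc (q + p + 1) N, lagSum p a f t ^ 2
      ≤ (p + 1) ^ 2 * C ^ 2 * ∑ t ∈ Finset.Icc (q + 1) N, f t ^ 2 := by
  have h1 : ∀ t, lagSum p a f t ^ 2 ≤
      (p + 1) * ∑ i ∈ Finset.range (p + 1), C ^ 2 * f (t - i) ^ 2 := fun t => by
    have := sq_sum_le_card_mul_sum_sq (s := Finset.range (p + 1)) (f := fun i => a i * f (t - i))
    rw [Finset.card_range] at this
    push_cast at this
    refine this.trans ?_
    gcongr with i hi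
    rw [mul_pow, ← sq_abs (a i)]
    have := hC i (by have := Finset.mem_range.1 hi; omega)
    gcongr
  have h2 : ∀ i ∈ Finset.range (p + 1),
      ∑ t ∈ Finset.Icc (q + p + 1) N, f (t - i) ^ 2 ≤ ∑ t ∈ Finset.Icc (q + 1) N, f t ^ 2 := fun i hi => by
    have hi := Finset.mem_range.1 hi
    rw [← Finset.sum_image (s := Finset.Icc (q + p + 1) N) (g := fun t => t - i)
      (f := fun t => f t ^ 2)]
    · refine Finset.sum_le_sum_of_subset_of_nonneg ?_ fun _ _ _ => sq_nonneg _
      intro t ht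
      simp only [Finset.mem_image, Finset.mem_Icc] at ht ⊢
      omega
    · intro t ht t' ht' h
      simp only [Finset.coe_Icc, Set.mem_Icc] at ht ht' h
      omega
  calc _ ≤ ∑ t ∈ Finset.Icc (q + p + 1) N,
        (p + 1) * ∑ i ∈ Finset.range (p + 1), C ^ 2 * f (t - i) ^ 2 :=
        Finset.sum_le_sum fun t _ => h1 t
    _ = (p + 1) * ∑ i ∈ Finset.range (p + 1),
          C ^ 2 * ∑ t ∈ Finset.Icc (q + p + 1) N, f (t - i) ^ 2 := by
        rw [← Finset.mul_sum, Finset.sum_comm]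
        simp only [Finset.mul_sum]
    _ ≤ (p + 1) * ∑ i ∈ Finset.range (p + 1), C ^ 2 * ∑ t ∈ Finset.Icc (q + 1) N, f t ^ 2 := by
        gcongr with i hi
        exact h2 i hi
    _ = _ := by simp; ring

lemma sum_lagSum_sq_le {p N : ℕ} {a : ℕ → ℝ} {C : ℝ} (hC : ∀ i ≤ p, |a i| ≤ C) (f : ℕ → ℝ) :
    ∑ t ∈ Finset.Icc (p + 1) N, lagSum p a f t ^ 2
      ≤ (p + 1) ^ 2 * C ^ 2 * ∑ t ∈ Finset.Icc 1 N, f t ^ 2 := by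
  simpa only [zero_add] using sum_lagSum_sq_le_offset hC f 0

/-! ### Ordinary least squares residuals -/

lemma designFull_mulVec (T : ℕ) (l : RelConfig) (N : ℕ) (w : Fin T ⊕ Fin l.m → ℝ) (i : Fin N) :
    (designFull T l N *ᵥ w) i = fitted T l N (w ∘ Sum.inl) (w ∘ Sum.inr) (i + 1) := by
  simp [designFull, mulVec, dotProduct, fitted]

lemma olsResid_zero (T : ℕ) (l : RelConfig) (N : ℕ) (x : ℕ → ℝ) : olsResid T l N x 0 = 0 := by
  simp [olsResid]

lemma olsResid_of_lt {T : ℕ} {l : RelConfig} {N : ℕ} {x : ℕ → ℝ} {t : ℕ} (h : N < t) :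
    olsResid T l N x t = 0 := by
  rw [olsResid, dif_neg (by omega)]

lemma sum_Icc_one_eq_sum_fin (N : ℕ) (f : ℕ → ℝ) :
    ∑ t ∈ Finset.Icc 1 N, f t = ∑ i : Fin N, f (i + 1) := by
  rw [← Finset.sum_range (fun i => f (i + 1)), Finset.range_eq_Ico, Finset.sum_Ico_add' f 0 N 1]
  rfl

lemma exists_olsResid_eq (T : ℕ) (l : RelConfig) (N : ℕ) (x : ℕ → ℝ) :
    (∃ (s : Fin T → ℝ) (μ : Fin l.m → ℝ), ∀ t, 1 ≤ t → t ≤ N →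
      olsResid T l N x t = x t - fitted T l N s μ t) ∧
    ∑ t ∈ Finset.Icc 1 N, olsResid T l N x t ^ 2 ≤ ∑ t ∈ Finset.Icc 1 N, x t ^ 2 := by
  obtain ⟨w, hw, hmin, hle⟩ := exists_leastSquares (designFull T l N) (fun i => x (i + 1))
  have hval : ∀ i : Fin N, olsResid T l N x (i + 1) =
      projResid (designFull T l N) (fun i => x (i + 1)) i := fun i => by
    rw [olsResid, dif_pos ⟨by omega, by omega⟩]
    rfl
  constructor
  · refine ⟨w ∘ Sum.inl, w ∘ Sum.inr, fun t h1 h2 => ?_⟩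
    obtain ⟨k, rfl⟩ : ∃ k, t = k + 1 := ⟨t - 1, by omega⟩
    have := hval ⟨k, by omega⟩
    simp only at this
    rw [this, hw, Pi.sub_apply, designFull_mulVec]
  · rw [sum_Icc_one_eq_sum_fin, sum_Icc_one_eq_sum_fin]
    have h0 := hle 0
    rw [hmin, ← hw, mulVec_zero, sub_zero] at h0
    simpa [dotProduct, hval, ← sq] using h0

/-- The zero-padded residuals, shifted by `i`. -/
def shiftedResid (p T : ℕ) (l : RelConfig) (N : ℕ) (x : ℕ → ℝ) (i : ℕ) :
    EuclideanSpace ℝ (Fin (N + p)) :=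
  WithLp.toLp 2 fun k => olsResid T l N x (k + 1 - i)

/-- Padding by zeros makes the inner product depend on `j - i` alone, with no edge terms: this is
why the Yule-Walker Gram matrix is exactly Toeplitz. Truncated subtraction is harmless, since it
lands on time `0`, where the residual is zero. -/
lemma inner_shiftedResid_of_le {p T : ℕ} {l : RelConfig} {N : ℕ} {x : ℕ → ℝ} (hN : 0 < N)
    {i j : ℕ} (hij : i ≤ j) (hj : j ≤ p) :
    inner ℝ (shiftedResid p T l N x i) (shiftedResid p T l N x j)
      = N * gammaHat T l N x (j - i) := by
  have h1 : inner ℝ (shiftedResid p T l N x i) (shiftedResid p T l N x j)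
      = ∑ t ∈ Finset.Icc 1 (N + p), olsResid T l N x (t - i) * olsResid T l N x (t - j) := by
    rw [sum_Icc_one_eq_sum_fin]
    simp [shiftedResid, PiLp.inner_apply, mul_comm]
  have hN' : (N : ℝ) ≠ 0 := by exact_mod_cast hN.ne'
  rw [h1, gammaHat, mul_inv_cancel_left₀ hN']
  symm
  have h2 : ∑ t ∈ Finset.Icc (j - i + 1) N, olsResid T l N x t * olsResid T l N x (t - (j - i))
      = ∑ t ∈ (Finset.Icc (j - i + 1) N).image (· + i),
        olsResid T l N x (t - i) * olsResid T l N x (t - j) := by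
    rw [Finset.sum_image (fun a _ b _ h => by simpa using h)]
    refine Finset.sum_congr rfl fun t ht => ?_
    have := Finset.mem_Icc.1 ht
    rw [show t + i - i = t by omega, show t + i - j = t - (j - i) by omega]
  rw [h2]
  refine Finset.sum_subset ?_ ?_
  · intro t ht
    simp only [Finset.mem_image, Finset.mem_Icc] at ht ⊢
    omega
  · intro t ht hnt
    simp only [Finset.mem_image, Finset.mem_Icc, not_exists, not_and] at ht hnt
    by_cases h : t ≤ j
    · rw [show t - j = 0 by omega, olsResid_zero, mul_zero]
    · by_cases h' : N < t - i
      · rw [olsResid_of_lt h', zero_mul]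
      · exact absurd (by omega) (hnt (t - i) ⟨by omega, by omega⟩)

lemma inner_shiftedResid {p T : ℕ} {l : RelConfig} {N : ℕ} {x : ℕ → ℝ} (hN : 0 < N)
    {i j : ℕ} (hi : i ≤ p) (hj : j ≤ p) :
    inner ℝ (shiftedResid p T l N x i) (shiftedResid p T l N x j)
      = N * gammaHat T l N x ((i : ℤ) - j).natAbs := by
  rcases le_total i j with h | h
  · rw [inner_shiftedResid_of_le hN h hj]
    congr 2; omega
  · rw [real_inner_comm, inner_shiftedResid_of_le hN h hi]
    congr 2; omega

lemma norm_sq_shiftedResid_le {p T : ℕ} {l : RelConfig} {N : ℕ} {x : ℕ → ℝ} {κ G : ℝ}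
    (h : GoodSample p T l N x κ G) (hN : 0 < N) {i : ℕ} (hi : i ≤ p) :
    ‖shiftedResid p T l N x i‖ ^ 2 ≤ G * N := by
  have hN' : (N : ℝ) ≠ 0 := by exact_mod_cast hN.ne'
  rw [← real_inner_self_eq_norm_sq, inner_shiftedResid hN hi hi, sub_self, Int.natAbs_zero,
    gammaHat, mul_inv_cancel_left₀ hN']
  have := (exists_olsResid_eq T l N x).2
  simp only [Nat.sub_zero, zero_add, ← sq]
  exact this.trans h.upper

/-- The residuals are data minus one particular candidate mean function, so `GoodSample.lower`
applies on the times `p + 1, …, N`; the edge times contribute nonnegative terms. -/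
lemma norm_sq_sum_shiftedResid_ge {p T : ℕ} {l : RelConfig} {N : ℕ} {x : ℕ → ℝ} {κ G : ℝ}
    (h : GoodSample p T l N x κ G) (a : ℕ → ℝ) :
    κ * N * ∑ i ∈ Finset.range (p + 1), a i ^ 2
      ≤ ‖∑ i ∈ Finset.range (p + 1), a i • shiftedResid p T l N x i‖ ^ 2 := by
  obtain ⟨s, μ, hsμ⟩ := (exists_olsResid_eq T l N x).1
  have h1 : ‖∑ i ∈ Finset.range (p + 1), a i • shiftedResid p T l N x i‖ ^ 2
      = ∑ t ∈ Finset.Icc 1 (N + p), lagSum p a (olsResid T l N x) t ^ 2 := by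
    rw [EuclideanSpace.norm_sq_eq, sum_Icc_one_eq_sum_fin]
    simp [shiftedResid, lagSum]
  rw [h1]
  refine (h.lower a s μ).trans ?_
  have h2 : ∑ t ∈ Finset.Icc (p + 1) N, lagSum p a (fun t => x t - fitted T l N s μ t) t ^ 2
      = ∑ t ∈ Finset.Icc (p + 1) N, lagSum p a (olsResid T l N x) t ^ 2 := by
    refine Finset.sum_congr rfl fun t ht => ?_
    have ht := Finset.mem_Icc.1 ht
    congr 1
    refine Finset.sum_congr rfl fun i hi => ?_
    have hi := Finset.mem_range.1 hi
    rw [hsμ (t - i) (by omega) (by omega)]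
  rw [h2]
  refine Finset.sum_le_sum_of_subset_of_nonneg ?_ fun _ _ _ => sq_nonneg _
  intro t ht
  simp only [Finset.mem_Icc] at ht ⊢
  omega

/-! ### The Yule-Walker estimator on a well-behaved sample -/

/-- The sample autocovariance matrix. -/
abbrev gammaMatrix (p T : ℕ) (l : RelConfig) (N : ℕ) (x : ℕ → ℝ) : Matrix (Fin p) (Fin p) ℝ :=
  Matrix.of fun i j : Fin p => gammaHat T l N x ((i : ℤ) - (j : ℤ)).natAbs

lemma gammaMatrix_posDef {p T : ℕ} {l : RelConfig} {N : ℕ} {x : ℕ → ℝ} {κ G : ℝ}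
    (h : GoodSample p T l N x κ G) (hN : 0 < N) (hκ : 0 < κ) :
    (gammaMatrix p T l N x).PosDef := by
  have hN' : (0 : ℝ) < N := by exact_mod_cast hN
  refine Matrix.PosDef.of_dotProduct_mulVec_pos ?_ fun b hb => ?_
  · ext i j
    simp only [conjTranspose_apply, Matrix.of_apply, star_trivial]
    congr 1; omega
  -- The nondegeneracy bound concerns `p + 1` coefficients, so `b` is extended by zero at lag `p`.
  · set a : ℕ → ℝ := fun i => if hi : i < p then b ⟨i, hi⟩ else 0 with ha
    have hab : ∀ i : Fin p, a i = b i := fun i => by simp [ha]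
    have hap : a p = 0 := by simp [ha]
    have h1 := norm_sq_sum_shiftedResid_ge h a
    rw [Finset.sum_range_succ, Finset.sum_range_succ, hap, Finset.sum_range, Finset.sum_range] at h1
    simp only [hab, zero_smul, add_zero, ne_eq, OfNat.ofNat_ne_zero, not_false_eq_true,
      zero_pow] at h1
    have h2 : ‖∑ i : Fin p, b i • shiftedResid p T l N x i‖ ^ 2
        = N * (b ⬝ᵥ (gammaMatrix p T l N x *ᵥ b)) := by
      simp only [← real_inner_self_eq_norm_sq, sum_inner, inner_sum, real_inner_smul_left,
        real_inner_smul_right, dotProduct, mulVec, Finset.mul_sum]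
      refine Finset.sum_congr rfl fun i _ => Finset.sum_congr rfl fun j _ => ?_
      have hentry : gammaMatrix p T l N x i j = gammaHat T l N x ((i : ℤ) - j).natAbs := rfl
      rw [inner_shiftedResid hN j.2.le i.2.le, hentry,
        show ((j : ℤ) - i).natAbs = ((i : ℤ) - j).natAbs by omega]
      ring
    rw [h2] at h1
    have h3 : 0 < ∑ i, b i ^ 2 := by
      obtain ⟨i, hi⟩ := Function.ne_iff.1 hb
      exact Finset.sum_pos' (fun _ _ => sq_nonneg _) ⟨i, Finset.mem_univ _, by
        have : b i ≠ 0 := hi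
        positivity⟩
    have h4 : 0 < κ * N * ∑ i, b i ^ 2 := by positivity
    rw [star_trivial]
    exact pos_of_mul_pos_right (h4.trans_le h1) (Nat.cast_nonneg N)

/-- The Yule-Walker equations. -/
lemma yuleWalker_orthogonal {p T : ℕ} {l : RelConfig} {N : ℕ} {x : ℕ → ℝ} {κ G : ℝ}
    (h : GoodSample p T l N x κ G) (hN : 0 < N) (hκ : 0 < κ) {j : ℕ} (h1 : 1 ≤ j) (hj : j ≤ p) :
    inner ℝ (∑ i ∈ Finset.range (p + 1), arCoeff (phiHat p T l N x) i • shiftedResid p T l N x i)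
      (shiftedResid p T l N x j) = 0 := by
  have hdet : IsUnit (gammaMatrix p T l N x).det :=
    (Matrix.isUnit_iff_isUnit_det _).1 (gammaMatrix_posDef h hN hκ).isUnit
  have hYW : gammaMatrix p T l N x *ᵥ phiHat p T l N x =
      fun i : Fin p => gammaHat T l N x (i + 1) := by
    rw [phiHat, mulVec_mulVec, Matrix.mul_nonsing_inv _ hdet, one_mulVec]
  obtain ⟨k, rfl⟩ : ∃ k, j = k + 1 := ⟨j - 1, by omega⟩
  have hk := congrFun hYW ⟨k, by omega⟩
  simp only [mulVec, dotProduct, Matrix.of_apply] at hk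
  rw [sum_range_arCoeff, inner_sub_left, sum_inner, inner_shiftedResid hN (Nat.zero_le _) hj,
    sub_eq_zero, show (((0 : ℕ) : ℤ) - ((k + 1 : ℕ) : ℤ)).natAbs = k + 1 by omega, ← hk,
    Finset.mul_sum]
  refine Finset.sum_congr rfl fun i _ => ?_
  rw [real_inner_smul_left, inner_shiftedResid hN (by omega) hj,
    show (((i + 1 : ℕ) : ℤ) - ((k + 1 : ℕ) : ℤ)).natAbs = ((k : ℤ) - i).natAbs by omega]
  ring

/-- On a well-behaved sample the Yule-Walker filter is bounded, and bounded below on periodic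
sequences. -/
theorem yuleWalker_bounds {p T : ℕ} [NeZero T] {l : RelConfig} {N : ℕ} {x : ℕ → ℝ} {κ G : ℝ}
    (h : GoodSample p T l N x κ G) (hN : 0 < N) (hκ : 0 < κ) :
    (∀ i ≤ p, |arCoeff (phiHat p T l N x) i| ≤ G / κ + 1) ∧
    ∀ f : ZMod T → ℝ, κ ^ 2 * ∑ u, f u ^ 2 ≤ (2 * G * (p + 1) ^ 2 * (G / κ + 1)) ^ 2 * T *
      ∑ u : ZMod T, (∑ i ∈ Finset.range (p + 1), arCoeff (phiHat p T l N x) i * f (u - i)) ^ 2 := by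
  have hN' : (0 : ℝ) < N := by exact_mod_cast hN
  set c := arCoeff (phiHat p T l N x) with hc
  set v := shiftedResid p T l N x with hv
  set Y := ∑ i ∈ Finset.range (p + 1), c i • v i with hY
  have hc0 : c 0 = 1 := rfl
  have horth : ∀ j, 1 ≤ j → j ≤ p → inner ℝ Y (v j) = 0 := fun j h1 hj =>
    yuleWalker_orthogonal h hN hκ h1 hj
  -- Since the leading coefficient is `1` and `Y` is orthogonal to the lagged vectors, `Y` is a
  -- least squares residual of `v 0`, hence no longer than `v 0`.
  have hYY : ‖Y‖ ^ 2 = inner ℝ Y (v 0) := by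
    rw [← real_inner_self_eq_norm_sq]
    conv_lhs => rw [hY, inner_sum]
    rw [Finset.sum_range_succ', Finset.sum_eq_zero, zero_add, hc0, one_smul]
    intro i hi
    have := Finset.mem_range.1 hi
    rw [real_inner_smul_right, horth (i + 1) (by omega) (by omega), mul_zero]
  have hYle : ‖Y‖ ^ 2 ≤ G * N := by
    have h1 : ‖Y‖ ^ 2 ≤ ‖Y‖ * ‖v 0‖ := hYY.le.trans (real_inner_le_norm _ _)
    have h2 := norm_sq_shiftedResid_le h hN (Nat.zero_le p)
    have h3 : 0 ≤ (‖Y‖ - ‖v 0‖) ^ 2 := sq_nonneg _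
    have h4 : ‖v 0‖ ^ 2 ≤ G * N := h2
    nlinarith
  have hYge : κ * N * ∑ i ∈ Finset.range (p + 1), c i ^ 2 ≤ ‖Y‖ ^ 2 :=
    norm_sq_sum_shiftedResid_ge h c
  have hsq : ∀ i ≤ p, c i ^ 2 ≤ ∑ i ∈ Finset.range (p + 1), c i ^ 2 := fun i hi =>
    Finset.single_le_sum (f := fun i => c i ^ 2) (fun _ _ => sq_nonneg _)
      (Finset.mem_range.2 (by omega))
  have hsum : ∑ i ∈ Finset.range (p + 1), c i ^ 2 ≤ G / κ := by
    rw [le_div_iff₀ hκ]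
    have := hYge.trans hYle
    refine le_of_mul_le_mul_right ?_ hN'
    linarith
  have hCb : ∀ i ≤ p, |c i| ≤ G / κ + 1 := fun i hi => by
    have := (hsq i hi).trans hsum
    rw [← sq_abs] at this
    nlinarith [sq_nonneg (|c i| - 1)]
  refine ⟨hCb, fun f => ?_⟩
  have hYκ : κ * N ≤ ‖Y‖ ^ 2 := by
    refine le_trans ?_ hYge
    have := hsq 0 (Nat.zero_le _)
    rw [hc0, one_pow] at this
    exact le_mul_of_one_le_right (by positivity) this
  have hmain := periodic_filter_lower_bound (T := T) (p := p) (v := v) (c := c) (g := G * N)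
    (fun i hi j hj => by
      rw [hv, inner_shiftedResid hN (by omega) (by omega),
        inner_shiftedResid hN (by omega) (by omega)]
      congr 2; omega) hc0 hCb (fun i hi => norm_sq_shiftedResid_le h hN hi) horth f
  have hs : 0 ≤ ∑ u, f u ^ 2 := Finset.sum_nonneg fun _ _ => sq_nonneg _
  have h5 : (κ * N) ^ 2 * ∑ u, f u ^ 2 ≤ (‖Y‖ ^ 2) ^ 2 * ∑ u, f u ^ 2 := by gcongr
  have h6 := h5.trans hmain
  -- Both `‖Y‖²` and the bound `G * N` on `‖v i‖²` scale like `N`, so a common `N²` cancels and the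
  -- constants are free of `N`.
  refine le_of_mul_le_mul_left (a := (N : ℝ) ^ 2) ?_ (by positivity)
  calc _ = (κ * N) ^ 2 * ∑ u, f u ^ 2 := by ring
    _ ≤ _ := h6
    _ = _ := by ring

/-! ### Regimes of a configuration -/

namespace RelConfig

lemma ext_zero (l : RelConfig) : l.ext 0 = 0 := by simp [ext]

lemma ext_nonneg (l : RelConfig) (r : ℕ) : 0 ≤ l.ext r := by
  unfold ext
  split_ifs with h1 h2
  · exact le_rfl
  · exact (l.pos _).le
  · exact zero_le_one

lemma ext_le_one (l : RelConfig) (r : ℕ) : l.ext r ≤ 1 := by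
  unfold ext
  split_ifs with h1 h2
  · exact zero_le_one
  · exact (l.lt_one _).le
  · exact le_rfl

lemma ext_mono (l : RelConfig) : Monotone l.ext := by
  refine monotone_nat_of_le_succ fun r => ?_
  rcases Nat.eq_zero_or_pos r with rfl | hr
  · rw [ext_zero]; exact l.ext_nonneg _
  · unfold ext
    simp only [hr.ne', if_false, Nat.succ_ne_zero, Nat.add_sub_cancel]
    split_ifs with h1 h2 h2
    · exact l.strictMono.monotone (by rw [Fin.mk_le_mk]; omega)
    · exact (l.lt_one _).le
    · omega
    · exact le_rfl

lemma tau_zero (l : RelConfig) (N : ℕ) : l.tau N 0 = 1 := by simp [tau]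

lemma tau_le_ext (l : RelConfig) (N : ℕ) {r : ℕ} (hr : r ≤ l.m) :
    (l.tau N r : ℝ) ≤ l.ext r * N + 1 := by
  rcases Nat.eq_zero_or_pos r with rfl | h
  · simp [tau_zero, ext_zero]
  · rw [tau, if_neg h.ne', if_pos hr]
    have := Nat.floor_le (mul_nonneg (l.ext_nonneg r) (Nat.cast_nonneg N))
    linarith

lemma ext_le_tau (l : RelConfig) (N : ℕ) {r : ℕ} (hr : 1 ≤ r) :
    l.ext r * N - 1 ≤ l.tau N r := by
  rw [tau, if_neg (by omega)]
  split_ifs with h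
  · exact (Nat.sub_one_lt_floor _).le
  · have := mul_le_of_le_one_left (Nat.cast_nonneg (α := ℝ) N) (l.ext_le_one r)
    push_cast
    linarith

lemma tau_le (l : RelConfig) (N : ℕ) (r : ℕ) : l.tau N r ≤ N + 1 := by
  unfold tau
  split_ifs
  · omega
  · refine Nat.le_succ_of_le (Nat.floor_le_of_le ?_)
    exact mul_le_of_le_one_left (Nat.cast_nonneg N) (l.ext_le_one r)
  · exact le_rfl

lemma tau_mono (l : RelConfig) {N : ℕ} (h1 : 1 ≤ l.tau N 1) : Monotone (l.tau N) := by
  refine monotone_nat_of_le_succ fun r => ?_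
  rcases Nat.eq_zero_or_pos r with rfl | hr
  · rw [tau_zero]; exact h1
  · by_cases h : r + 1 ≤ l.m
    · rw [tau.eq_def l N r, tau.eq_def l N (r + 1), if_neg hr.ne', if_pos (show r ≤ l.m by omega),
        if_neg (Nat.succ_ne_zero r), if_pos h]
      exact Nat.floor_mono (mul_le_mul_of_nonneg_right (l.ext_mono (Nat.le_succ r))
        (Nat.cast_nonneg N))
    · rw [tau.eq_def l N (r + 1), if_neg (by omega), if_neg h]
      exact l.tau_le N r

end RelConfig

/-- The loss of `2` covers the floor at the right end and the value `τ_0 = 1` in place of `0` at the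
left end. -/
lemma regime_length_ge {M : ℕ} {d : ℝ} {l : RelConfig} (hl : l ∈ Lam M d) (N : ℕ) {r : ℕ}
    (hr : r ≤ l.m) : d * N - 2 ≤ (l.tau N (r + 1) : ℝ) - l.tau N r := by
  have h1 := l.tau_le_ext N hr
  have h2 := l.ext_le_tau N (r := r + 1) (by omega)
  have h3 := hl.2 (r + 1) (Finset.mem_Icc.2 ⟨by omega, by omega⟩)
  rw [Nat.add_sub_cancel] at h3
  have h4 : d * N ≤ (l.ext (r + 1) - l.ext r) * N :=
    mul_le_mul_of_nonneg_right h3 (Nat.cast_nonneg N)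
  linarith

/-- The mean of regime `r + 1` relative to the first one. -/
def regimeMean (l : RelConfig) (μ : Fin l.m → ℝ) : ℕ → ℝ
  | 0 => 0
  | r + 1 => if h : r < l.m then μ ⟨r, h⟩ else 0

lemma season_eq (T : ℕ) {t : ℕ} (ht : 1 ≤ t) : season T t = (t - 1) % T + 1 := by
  have := Nat.mod_add_div (t - 1) T
  unfold season
  generalize T * ((t - 1) / T) = q at *
  omega

/-- The seasonal means as a function on `ℤ / T`. -/
def seasonMean {T : ℕ} [NeZero T] (s : Fin T → ℝ) (u : ZMod T) : ℝ := s ⟨(u - 1).val, ZMod.val_lt _⟩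

lemma seasonMean_natCast {T : ℕ} [NeZero T] (s : Fin T → ℝ) {t : ℕ} (ht : 1 ≤ t) :
    ∑ v, seasonInd T t v * s v = seasonMean s (t : ZMod T) := by
  have hval : (((t : ZMod T) - 1).val) = (t - 1) % T := by
    rw [← ZMod.val_natCast, Nat.cast_sub ht, Nat.cast_one]
  rw [Finset.sum_eq_single ⟨(t - 1) % T, Nat.mod_lt _ (NeZero.pos T)⟩]
  · simp [seasonInd, season_eq T ht, seasonMean, hval]
  · intro v _ hv
    have : ¬ season T t = (v : ℕ) + 1 := by
      rw [season_eq T ht]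
      intro h
      exact hv (Fin.ext (by simpa using h.symm))
    rw [seasonInd, if_neg this, zero_mul]
  · simp

lemma sum_seasonMean_sq {T : ℕ} [NeZero T] (s : Fin T → ℝ) :
    ∑ u, seasonMean s u ^ 2 = ∑ v, s v ^ 2 := by
  refine Finset.sum_bij (fun u _ => ⟨(u - 1).val, ZMod.val_lt _⟩) (fun _ _ => Finset.mem_univ _)
    ?_ ?_ fun _ _ => rfl
  · intro u _ w _ h
    have := ZMod.val_injective T (Fin.mk.inj_iff.1 h)
    exact sub_left_injective this
  · intro v _
    refine ⟨((v : ℕ) : ZMod T) + 1, Finset.mem_univ _, Fin.ext ?_⟩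
    simp [ZMod.val_natCast, Nat.mod_eq_of_lt v.2]

/-- The condition `1 ≤ l.tau N 1`, which can fail for small `N`, makes the changepoint times
monotone; the regimes are then disjoint and exactly one indicator can be active. -/
lemma fitted_eq_of_mem_regime {T : ℕ} [NeZero T] {l : RelConfig} {N : ℕ} (h1 : 1 ≤ l.tau N 1)
    (s : Fin T → ℝ) (μ : Fin l.m → ℝ) {r t : ℕ} (hr : r ≤ l.m) (ht : l.tau N r ≤ t)
    (ht' : t < l.tau N (r + 1)) :
    fitted T l N s μ t = seasonMean s (t : ZMod T) + regimeMean l μ r := by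
  have hmono := l.tau_mono h1
  have ht1 : 1 ≤ t := by
    have := hmono (Nat.zero_le r)
    rw [RelConfig.tau_zero] at this
    omega
  rw [fitted, seasonMean_natCast s ht1]
  congr 1
  have hind : ∀ q : Fin l.m, regimeInd l N t q = if (q : ℕ) + 1 = r then 1 else 0 := fun q => by
    unfold regimeInd
    by_cases h : (q : ℕ) + 1 = r
    · rw [if_pos h, if_pos]
      subst h
      exact ⟨ht, ht'⟩
    · rw [if_neg h, if_neg]
      rintro ⟨ha, hb⟩
      rcases lt_or_gt_of_ne h with hlt | hgt
      · have := hmono (show (q : ℕ) + 2 ≤ r by omega)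
        omega
      · have := hmono (show r + 1 ≤ (q : ℕ) + 1 by omega)
        omega
  simp only [hind]
  rcases r with _ | r
  · simp [regimeMean]
  · rw [Finset.sum_eq_single ⟨r, by omega⟩]
    · simp [regimeMean, show r < l.m by omega]
    · intro q _ hq
      have : ¬ (q : ℕ) + 1 = r + 1 := fun h => hq (Fin.ext (by simpa using h))
      rw [if_neg this, zero_mul]
    · simp

/-! ### Lower bound for filtered mean functions -/

lemma sum_range_natCast_zmod {T : ℕ} [NeZero T] (g : ZMod T → ℝ) :
    ∑ k ∈ Finset.range T, g (k : ZMod T) = ∑ u, g u := by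
  refine Finset.sum_bij (fun k _ => (k : ZMod T)) (fun _ _ => Finset.mem_univ _) ?_ ?_
    fun _ _ => rfl
  · intro a ha b hb h
    have := congrArg ZMod.val h
    simpa [ZMod.val_natCast, Nat.mod_eq_of_lt (Finset.mem_range.1 ha),
      Nat.mod_eq_of_lt (Finset.mem_range.1 hb)] using this
  · intro u _
    exact ⟨u.val, Finset.mem_range.2 (ZMod.val_lt u), by simp⟩

lemma sum_Ico_natCast_zmod {T : ℕ} [NeZero T] (g : ZMod T → ℝ) (A q : ℕ) :
    ∑ t ∈ Finset.Ico A (A + q * T), g (t : ZMod T) = q * ∑ u, g u := by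
  induction q with
  | zero => simp
  | succ q ih =>
    rw [← Finset.sum_Ico_consecutive _ (show A ≤ A + q * T by omega)
      (show A + q * T ≤ A + (q + 1) * T by nlinarith), ih,
      show A + (q + 1) * T = A + q * T + T by ring, Finset.sum_Ico_eq_sum_range,
      Nat.add_sub_cancel_left]
    have : ∑ k ∈ Finset.range T, g ((A + q * T + k : ℕ) : ZMod T) = ∑ u, g u := by
      rw [← Equiv.sum_comp (Equiv.addLeft ((A + q * T : ℕ) : ZMod T)), ← sum_range_natCast_zmod]
      refine Finset.sum_congr rfl fun k _ => ?_
      rw [Equiv.coe_addLeft, Nat.cast_add (A + q * T) k]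
    rw [this]
    push_cast
    ring

/-- After the first `p` times of a regime all lags stay inside it, where the mean function is
periodic. Each of the `q` complete periods that follow contributes the full sum over `ZMod T`. -/
lemma regime_filter_lower_bound {p T : ℕ} [NeZero T] {l : RelConfig} {N : ℕ}
    (h1 : 1 ≤ l.tau N 1) {c : ℕ → ℝ} {η : ℝ}
    (hc : ∀ f : ZMod T → ℝ, η * ∑ u, f u ^ 2
      ≤ ∑ u : ZMod T, (∑ i ∈ Finset.range (p + 1), c i * f (u - i)) ^ 2)
    (s : Fin T → ℝ) (μ : Fin l.m → ℝ) {r q : ℕ} (hr : r ≤ l.m)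
    (hq : l.tau N r + p + q * T ≤ l.tau N (r + 1)) :
    η * q * ∑ u, (seasonMean s u + regimeMean l μ r) ^ 2
      ≤ ∑ t ∈ Finset.Icc (p + 1) N, lagSum p c (fitted T l N s μ) t ^ 2 := by
  set f : ZMod T → ℝ := fun u => seasonMean s u + regimeMean l μ r with hf
  have hτ : 1 ≤ l.tau N r := by
    have := l.tau_mono h1 (Nat.zero_le r)
    rwa [RelConfig.tau_zero] at this
  have hτ' := l.tau_le N (r + 1)
  calc η * q * ∑ u, f u ^ 2 = q * (η * ∑ u, f u ^ 2) := by ring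
    _ ≤ q * ∑ u : ZMod T, (∑ i ∈ Finset.range (p + 1), c i * f (u - i)) ^ 2 := by
        gcongr; exact hc f
    _ = ∑ t ∈ Finset.Ico (l.tau N r + p) (l.tau N r + p + q * T),
          (∑ i ∈ Finset.range (p + 1), c i * f ((t : ZMod T) - i)) ^ 2 :=
        (sum_Ico_natCast_zmod
          (fun u : ZMod T => (∑ i ∈ Finset.range (p + 1), c i * f (u - i)) ^ 2) _ q).symm
    _ = ∑ t ∈ Finset.Ico (l.tau N r + p) (l.tau N r + p + q * T),
          lagSum p c (fitted T l N s μ) t ^ 2 := by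
        refine Finset.sum_congr rfl fun t ht => ?_
        have ht := Finset.mem_Ico.1 ht
        congr 1
        refine Finset.sum_congr rfl fun i hi => ?_
        have hi := Finset.mem_range.1 hi
        rw [fitted_eq_of_mem_regime h1 s μ hr (t := t - i) (by omega) (by omega),
          Nat.cast_sub (by omega)]
    _ ≤ _ := by
        refine Finset.sum_le_sum_of_subset_of_nonneg ?_ fun _ _ _ => sq_nonneg _
        intro t ht
        simp only [Finset.mem_Ico, Finset.mem_Icc] at ht ⊢
        omega

/-- A filter that is bounded below on periodic sequences is bounded below on the mean functions
of a configuration with long regimes. -/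
theorem design_lower_bound {p T : ℕ} [NeZero T] {M : ℕ} {d : ℝ} (hd : 0 < d) {l : RelConfig}
    (hl : l ∈ Lam M d) :
    ∃ ρ : ℝ, 0 < ρ ∧ ∃ N₀ : ℕ, ∀ N ≥ N₀, ∀ (c : ℕ → ℝ) (η : ℝ), 0 ≤ η →
      (∀ f : ZMod T → ℝ, η * ∑ u, f u ^ 2
        ≤ ∑ u : ZMod T, (∑ i ∈ Finset.range (p + 1), c i * f (u - i)) ^ 2) →
      ∀ (s : Fin T → ℝ) (μ : Fin l.m → ℝ),
        η * ρ * N * (∑ v, s v ^ 2 + ∑ r, μ r ^ 2)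
          ≤ ∑ t ∈ Finset.Icc (p + 1) N, lagSum p c (fitted T l N s μ) t ^ 2 := by
  have hT : (1 : ℝ) ≤ T := by exact_mod_cast NeZero.one_le
  have hT0 : 0 < T := NeZero.pos T
  -- Half of the relative length `d` absorbs rounding, the `p` initial times and an incomplete
  -- period, leaving at least `d N / (2T)` periods per regime. The factor `1 + 4m` comes from adding
  -- the bounds for the seasonal means and for the `m` regime means.
  refine ⟨d / (2 * T) / (1 + 4 * l.m), by positivity,
    ⌈2 * (3 + p + T) / d⌉₊, fun N hN c η hη hc s μ => ?_⟩
  have hNd : 2 * (3 + p + T) ≤ d * N := by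
    have := (Nat.le_ceil _).trans (Nat.cast_le (α := ℝ).2 hN)
    rwa [div_le_iff₀ hd, mul_comm (N : ℝ)] at this
  have h1 : 1 ≤ l.tau N 1 := by
    have h := regime_length_ge hl N (Nat.zero_le l.m)
    rw [RelConfig.tau_zero] at h
    have : (0 : ℝ) < l.tau N 1 := by
      push_cast at h
      linarith [Nat.cast_nonneg (α := ℝ) p]
    exact_mod_cast this
  set tot := ∑ t ∈ Finset.Icc (p + 1) N, lagSum p c (fitted T l N s μ) t ^ 2 with htot
  have key : ∀ r ≤ l.m, η * (d / (2 * T) * N) *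
      ∑ u, (seasonMean s u + regimeMean l μ r) ^ 2 ≤ tot := fun r hr => by
    have hlen := regime_length_ge hl N hr
    set L := l.tau N (r + 1) - l.tau N r with hL
    have hmono : l.tau N r ≤ l.tau N (r + 1) := l.tau_mono h1 (Nat.le_succ r)
    have hLr : (L : ℝ) = (l.tau N (r + 1) : ℝ) - l.tau N r := by rw [hL, Nat.cast_sub hmono]
    have hpL : p ≤ L := by
      have : (p : ℝ) ≤ L := by linarith
      exact_mod_cast this
    set q := (L - p) / T with hq
    have hqT : q * T ≤ L - p := Nat.div_mul_le_self _ _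
    have hqT' : L - p < q * T + T := by
      have := Nat.lt_div_mul_add hT0 (a := L - p)
      exact this
    have hqT'' : (L : ℝ) - p < q * T + T := by
      rw [← Nat.cast_sub hpL]; exact_mod_cast hqT'
    have hqge : d / (2 * T) * N ≤ q := by
      rw [div_mul_eq_mul_div, div_le_iff₀ (by positivity)]
      linarith
    refine le_trans ?_ (regime_filter_lower_bound h1 hc s μ hr (q := q) (by omega))
    have : 0 ≤ ∑ u : ZMod T, (seasonMean s u + regimeMean l μ r) ^ 2 :=
      Finset.sum_nonneg fun _ _ => sq_nonneg _
    gcongr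
  -- The first regime has mean zero, so it identifies the seasonal means alone; every other regime
  -- mean is then recovered by subtraction.
  have hs : η * (d / (2 * T) * N) * ∑ v, s v ^ 2 ≤ tot := by
    have := key 0 (Nat.zero_le _)
    simpa [regimeMean, sum_seasonMean_sq] using this
  have hμ : ∀ r : Fin l.m, η * (d / (2 * T) * N) * μ r ^ 2 ≤ 4 * tot := fun r => by
    have hk := key (r + 1) (by omega)
    have hrm : regimeMean l μ (r + 1) = μ r := by simp [regimeMean]
    rw [hrm] at hk
    have h2 : μ r ^ 2 ≤ 2 * ∑ u, (seasonMean s u + μ r) ^ 2 + 2 * ∑ v, s v ^ 2 := by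
      rw [← sum_seasonMean_sq, Finset.mul_sum, Finset.mul_sum, ← Finset.sum_add_distrib]
      refine le_trans ?_ (Finset.single_le_sum (f := fun u : ZMod T =>
        2 * (seasonMean s u + μ r) ^ 2 + 2 * seasonMean s u ^ 2)
        (fun _ _ => by positivity) (Finset.mem_univ 0))
      nlinarith [sq_nonneg (2 * seasonMean s 0 + μ r)]
    have h3 : 0 ≤ η * (d / (2 * T) * N) := by positivity
    nlinarith
  have hμsum : η * (d / (2 * T) * N) * ∑ r, μ r ^ 2 ≤ l.m * (4 * tot) := by
    rw [Finset.mul_sum]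
    refine (Finset.sum_le_sum fun r _ => hμ r).trans (le_of_eq (by simp))
  have hfin : η * (d / (2 * T) * N) * (∑ v, s v ^ 2 + ∑ r, μ r ^ 2) ≤ (1 + 4 * l.m) * tot := by
    linarith
  calc _ = (η * (d / (2 * T) * N) * (∑ v, s v ^ 2 + ∑ r, μ r ^ 2)) / (1 + 4 * l.m) := by ring
    _ ≤ tot := by rw [div_le_iff₀ (by positivity)]; linarith

/-! ### Determinants and quadratic forms -/

/-- At unit eigenvectors the quadratic form takes the eigenvalues as values, so all of them lie in
`[α, β]`; the determinant is their product. -/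
lemma det_bounds_of_quadForm {m : ℕ} {R : Matrix (Fin m) (Fin m) ℝ} (hR : R.IsHermitian)
    {α β : ℝ} (hα : 0 ≤ α) (h1 : ∀ u : Fin m → ℝ, α * (u ⬝ᵥ u) ≤ u ⬝ᵥ (R *ᵥ u))
    (h2 : ∀ u : Fin m → ℝ, u ⬝ᵥ (R *ᵥ u) ≤ β * (u ⬝ᵥ u)) :
    α ^ m ≤ R.det ∧ R.det ≤ β ^ m := by
  have hev : ∀ i, α ≤ hR.eigenvalues i ∧ hR.eigenvalues i ≤ β := fun i => by
    set e : Fin m → ℝ := ⇑(hR.eigenvectorBasis i) with he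
    have hee : e ⬝ᵥ e = 1 := by
      have := hR.eigenvectorBasis.orthonormal.1 i
      have h : ‖hR.eigenvectorBasis i‖ ^ 2 = 1 := by rw [this, one_pow]
      rw [EuclideanSpace.norm_sq_eq] at h
      simpa [dotProduct, ← sq] using h
    have hRe : R *ᵥ e = hR.eigenvalues i • e := hR.mulVec_eigenvectorBasis i
    have hq : e ⬝ᵥ (R *ᵥ e) = hR.eigenvalues i := by
      rw [hRe, dotProduct_smul, hee, smul_eq_mul, mul_one]
    have ha := h1 e
    have hb := h2 e
    rw [hq, hee, mul_one] at ha hb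
    exact ⟨ha, hb⟩
  have hdet : R.det = ∏ i, hR.eigenvalues i := by
    simpa using hR.det_eq_prod_eigenvalues
  rw [hdet]
  constructor
  · calc α ^ m = ∏ _i : Fin m, α := by simp
      _ ≤ _ := Finset.prod_le_prod (fun _ _ => hα) fun i _ => (hev i).1
  · calc _ ≤ ∏ _i : Fin m, β :=
          Finset.prod_le_prod (fun i _ => hα.trans (hev i).1) fun i _ => (hev i).2
      _ = β ^ m := by simp

/-! ### The filtered regression -/

section Filtered

variable {p T : ℕ} {l : RelConfig} {N : ℕ} {x : ℕ → ℝ}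

lemma sum_fin_sub_eq (p N : ℕ) (f : ℕ → ℝ) :
    ∑ k : Fin (N - p), f (p + 1 + k) = ∑ t ∈ Finset.Icc (p + 1) N, f t := by
  rw [← Finset.sum_range (fun k => f (p + 1 + k)), ← Finset.Ico_add_one_right_eq_Icc,
    Finset.sum_Ico_eq_sum_range]
  congr 2
  omega

lemma lagSum_fitted (c : ℕ → ℝ) (s : Fin T → ℝ) (u : Fin l.m → ℝ) (t : ℕ) :
    lagSum p c (fitted T l N s u) t
      = ∑ v, lagSum p c (fun t => seasonInd T t v) t * s v
        + ∑ r, lagSum p c (fun t => regimeInd l N t r) t * u r := by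
  simp only [lagSum, fitted, mul_add, Finset.sum_add_distrib, Finset.mul_sum, Finset.sum_mul]
  congr 1
  · rw [Finset.sum_comm]
    exact Finset.sum_congr rfl fun _ _ => Finset.sum_congr rfl fun _ _ => by ring
  · rw [Finset.sum_comm]
    exact Finset.sum_congr rfl fun _ _ => Finset.sum_congr rfl fun _ _ => by ring

lemma lagSum_sub (c f g : ℕ → ℝ) (t : ℕ) :
    lagSum p c (fun t => f t - g t) t = lagSum p c f t - lagSum p c g t := by
  simp [lagSum, mul_sub, Finset.sum_sub_distrib]

/-- Filtering is linear, so combinations of the filtered columns are filtered mean functions. This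
carries the bounds on `lagSum` over to the regression. -/
lemma hat_mulVec_apply (s : Fin T → ℝ) (u : Fin l.m → ℝ) (k : Fin (N - p)) :
    (AHat p T l N x *ᵥ s) k + (DHat p T l N x *ᵥ u) k
      = lagSum p (arCoeff (phiHat p T l N x)) (fitted T l N s u) (p + 1 + k) := by
  simp only [lagSum_fitted, AHat, DHat, mulVec, dotProduct, Matrix.of_apply, arFilter_eq_lagSum]

lemma hat_mulVec_dotProduct_self (s : Fin T → ℝ) (u : Fin l.m → ℝ) :
    (AHat p T l N x *ᵥ s + DHat p T l N x *ᵥ u) ⬝ᵥ (AHat p T l N x *ᵥ s + DHat p T l N x *ᵥ u)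
      = ∑ t ∈ Finset.Icc (p + 1) N,
        lagSum p (arCoeff (phiHat p T l N x)) (fitted T l N s u) t ^ 2 := by
  rw [← sum_fin_sub_eq p N
    (fun t => lagSum p (arCoeff (phiHat p T l N x)) (fitted T l N s u) t ^ 2)]
  simp only [dotProduct, Pi.add_apply, hat_mulVec_apply, ← sq]

lemma hat_resid_dotProduct_self (s : Fin T → ℝ) (u : Fin l.m → ℝ) :
    (XHat p T l N x - AHat p T l N x *ᵥ s - DHat p T l N x *ᵥ u) ⬝ᵥ
        (XHat p T l N x - AHat p T l N x *ᵥ s - DHat p T l N x *ᵥ u)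
      = ∑ t ∈ Finset.Icc (p + 1) N,
        lagSum p (arCoeff (phiHat p T l N x)) (fun t => x t - fitted T l N s u t) t ^ 2 := by
  rw [← sum_fin_sub_eq p N (fun t =>
    lagSum p (arCoeff (phiHat p T l N x)) (fun t => x t - fitted T l N s u t) t ^ 2)]
  simp only [dotProduct, Pi.sub_apply, sub_sub, hat_mulVec_apply, ← sq]
  simp only [lagSum_sub, XHat, arFilter_eq_lagSum]

lemma fitted_zero (t : ℕ) : fitted T l N 0 0 t = 0 := by simp [fitted]

lemma sum_sq_fitted_le (u : Fin l.m → ℝ) :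
    ∑ t ∈ Finset.Icc 1 N, fitted T l N 0 u t ^ 2 ≤ N * (l.m * (u ⬝ᵥ u)) := by
  have h : ∀ t, fitted T l N 0 u t ^ 2 ≤ l.m * (u ⬝ᵥ u) := fun t => by
    have h1 := sq_sum_le_card_mul_sum_sq (s := (Finset.univ : Finset (Fin l.m)))
      (f := fun r => regimeInd l N t r * u r)
    rw [Finset.card_univ, Fintype.card_fin] at h1
    have h2 : fitted T l N 0 u t = ∑ r, regimeInd l N t r * u r := by simp [fitted]
    rw [h2]
    refine h1.trans (mul_le_mul_of_nonneg_left (Finset.sum_le_sum fun r _ => ?_)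
      (Nat.cast_nonneg _))
    unfold regimeInd
    split_ifs
    · rw [one_mul, sq]
    · rw [zero_mul, zero_pow two_ne_zero]; exact mul_self_nonneg _
  refine (Finset.sum_le_sum fun t _ => h t).trans (le_of_eq ?_)
  simp

end Filtered

/-! ### Logarithms of quantities of the same order; size of the regime lengths -/

lemma abs_log_sub_log_le {a b α β : ℝ} (hb : 0 < b) (hα : 0 < α) (h1 : α * b ≤ a)
    (h2 : a ≤ β * b) : |Real.log a - Real.log b| ≤ |Real.log α| + |Real.log β| := by
  have ha : 0 < a := (mul_pos hα hb).trans_le h1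
  have hβ : 0 < β := pos_of_mul_pos_left (ha.trans_le h2) hb.le
  have h3 := Real.log_le_log (mul_pos hα hb) h1
  have h4 := Real.log_le_log ha h2
  rw [Real.log_mul hα.ne' hb.ne'] at h3
  rw [Real.log_mul hβ.ne' hb.ne'] at h4
  rw [abs_le]
  constructor
  · linarith [neg_abs_le (Real.log α), abs_nonneg (Real.log β)]
  · linarith [le_abs_self (Real.log β), abs_nonneg (Real.log α)]

/-- Each of the `m` regime lengths in the sum lies between `d N / 2` and `N` once `d N ≥ 2`, the
rounding loss being at most one. -/
lemma sum_log_regimeLen_bound {M : ℕ} {d : ℝ} (hd : 0 < d) {l : RelConfig} (hl : l ∈ Lam M d) :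
    ∃ K : ℝ, ∃ N₀ : ℕ, ∀ N ≥ N₀,
      |∑ r ∈ Finset.Icc 2 (l.m + 1), Real.log (l.regimeLen N r) - l.m * Real.log N| ≤ K := by
  refine ⟨l.m * (|Real.log (d / 2)| + |Real.log 1|), ⌈2 / d⌉₊ + 1, fun N hN => ?_⟩
  have hN1 : 0 < N := by omega
  have hN' : (0 : ℝ) < N := by exact_mod_cast hN1
  have hNd : 2 ≤ d * N := by
    have := (Nat.le_ceil (2 / d)).trans (Nat.cast_le (α := ℝ).2 (show ⌈2 / d⌉₊ ≤ N by omega))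
    rwa [div_le_iff₀ hd, mul_comm (N : ℝ)] at this
  have hterm : ∀ r ∈ Finset.Icc 2 (l.m + 1), |Real.log (l.regimeLen N r) - Real.log N|
      ≤ |Real.log (d / 2)| + |Real.log 1| := fun r hr => by
    have hr := Finset.mem_Icc.1 hr
    have hgap := hl.2 r (Finset.mem_Icc.2 ⟨by omega, hr.2⟩)
    have hg : d * N ≤ (l.ext r - l.ext (r - 1)) * N := mul_le_mul_of_nonneg_right hgap hN'.le
    have f1 := Nat.sub_one_lt_floor (l.ext r * N)
    have f2 := Nat.floor_le (mul_nonneg (l.ext_nonneg r) hN'.le)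
    have f3 := Nat.floor_le (mul_nonneg (l.ext_nonneg (r - 1)) hN'.le)
    have f4 : l.ext r * N ≤ 1 * N := mul_le_mul_of_nonneg_right (l.ext_le_one r) hN'.le
    have f5 : (0 : ℝ) ≤ (⌊l.ext (r - 1) * N⌋₊ : ℝ) := Nat.cast_nonneg _
    refine abs_log_sub_log_le hN' (by positivity) ?_ ?_
    · unfold RelConfig.regimeLen; nlinarith
    · unfold RelConfig.regimeLen; linarith
  have hcard : (l.m : ℝ) * Real.log N = ∑ _r ∈ Finset.Icc 2 (l.m + 1), Real.log N := by
    simp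
  rw [hcard, ← Finset.sum_sub_distrib]
  refine (Finset.abs_sum_le_sum_abs _ _).trans ((Finset.sum_le_sum hterm).trans (le_of_eq ?_))
  simp

/-! ### Comparison of the two criteria on a well-behaved sample -/

/-- On well-behaved samples the two residual variances are comparable at order `1 / N`, and the
determinant is comparable with the product of the regime lengths. -/
theorem goodSample_comparison {p T : ℕ} [NeZero T] {ν : ℝ} (hν : 0 < ν) {M : ℕ} {d : ℝ}
    (hd : 0 < d) {l : RelConfig} (hl : l ∈ Lam M d) {κ G : ℝ} (hκ : 0 < κ) (hG : 0 < G) :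
    ∃ K : ℝ, ∃ N₀ : ℕ, ∀ N ≥ N₀, ∀ x : ℕ → ℝ, GoodSample p T l N x κ G →
      |((N : ℝ) - p) / 2 * Real.log (sigmaSqHat p T ν l N x)
        - ((N : ℝ) - p) / 2 * Real.log (sigmaSqHatInf p T l N x)| ≤ K ∧
      |Real.log (ridgeGram p T ν l N x).det
        - ∑ r ∈ Finset.Icc 2 (l.m + 1), Real.log (l.regimeLen N r)| ≤ K := by
  obtain ⟨ρ, hρ, N₁, hdesign⟩ := design_lower_bound (p := p) (T := T) hd hl
  obtain ⟨K₂, N₂, hlen⟩ := sum_log_regimeLen_bound hd hl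
  have hT : (0 : ℝ) < T := by exact_mod_cast NeZero.pos T
  set C := G / κ + 1 with hC
  have hCpos : 0 < C := by positivity
  set η := κ ^ 2 / ((2 * G * (p + 1) ^ 2 * C) ^ 2 * T) with hη
  have hηpos : 0 < η := by positivity
  -- `K₁` bounds the penalty `|u₀|²/ν` at the unpenalised least squares solution, and hence the gap
  -- between the two minima.
  set K₁ := ν⁻¹ * (4 * ((p + 1) ^ 2 * C ^ 2 * G) / (η * ρ)) with hK₁
  have hK₁pos : 0 ≤ K₁ := by positivity
  set β := (p + 1 : ℝ) ^ 2 * C ^ 2 * l.m + ν⁻¹ with hβ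
  have hβpos : 0 < β := by positivity
  refine ⟨max (K₁ / (2 * κ)) (|Real.log ((η * ρ) ^ l.m)| + |Real.log (β ^ l.m)| + K₂),
    max (max N₁ N₂) (p + 1), fun N hN x hx => ?_⟩
  have hNp : p + 1 ≤ N := le_of_max_le_right hN
  have hN1 : N₁ ≤ N := le_of_max_le_left (le_of_max_le_left hN)
  have hN2 : N₂ ≤ N := le_of_max_le_right (le_of_max_le_left hN)
  have hN0 : 0 < N := by omega
  have hN' : (0 : ℝ) < N := by exact_mod_cast hN0
  have hN1' : (1 : ℝ) ≤ N := by exact_mod_cast hN0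
  have hn : (0 : ℝ) < (N : ℝ) - p := by
    have : (p : ℝ) + 1 ≤ N := by exact_mod_cast hNp
    linarith
  obtain ⟨hCb, hper⟩ := yuleWalker_bounds (T := T) hx hN0 hκ
  have hlow := hdesign N hN1 (arCoeff (phiHat p T l N x)) η hηpos.le fun f => by
    rw [hη, div_mul_eq_mul_div, div_le_iff₀ (by positivity), mul_comm _ (_ * (T : ℝ))]
    exact hper f
  set c := arCoeff (phiHat p T l N x) with hc
  set X := XHat p T l N x with hX
  set A := AHat p T l N x with hA
  set D := DHat p T l N x with hD
  have hR : ∀ s u, (X - A *ᵥ s - D *ᵥ u) ⬝ᵥ (X - A *ᵥ s - D *ᵥ u)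
      = ∑ t ∈ Finset.Icc (p + 1) N, lagSum p c (fun t => x t - fitted T l N s u t) t ^ 2 :=
    fun s u => hat_resid_dotProduct_self s u
  have hF : ∀ s u, (A *ᵥ s + D *ᵥ u) ⬝ᵥ (A *ᵥ s + D *ᵥ u)
      = ∑ t ∈ Finset.Icc (p + 1) N, lagSum p c (fitted T l N s u) t ^ 2 :=
    fun s u => hat_mulVec_dotProduct_self s u
  have hηρN : 0 < η * ρ * N := by positivity
  constructor
  · refine le_trans ?_ (le_max_left _ _)
    -- Injectivity of `Â`, which makes `Â'B̂Â` invertible, is the design bound with all regime means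
    -- zero.
    have hAinj : ∀ s : Fin T → ℝ, A *ᵥ s = 0 → s = 0 := fun s hs => by
      have h1 := hlow s 0
      rw [← hF, hs, mulVec_zero, add_zero, dotProduct_zero] at h1
      have h2 : ∑ v, s v ^ 2 ≤ 0 := by
        by_contra! h
        have := mul_pos hηρN h
        simp at h1
        linarith
      have h3 := (Finset.sum_eq_zero_iff_of_nonneg fun v _ => sq_nonneg (s v)).1
        (le_antisymm h2 (Finset.sum_nonneg fun _ _ => sq_nonneg _))
      funext v
      exact pow_eq_zero_iff two_ne_zero |>.1 (h3 v (Finset.mem_univ _))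
    obtain ⟨⟨s₁, u₁, hge⟩, hle⟩ := gls_quadForm_bounds A D hν hAinj X
    set Q := X ⬝ᵥ ((ridgeResid D ν - ridgeResid D ν * A * (Aᵀ * ridgeResid D ν * A)⁻¹ * Aᵀ *
      ridgeResid D ν) *ᵥ X) with hQ
    obtain ⟨w, -, hmin, hall⟩ := exists_leastSquares (Matrix.fromCols A D) X
    set R := X ⬝ᵥ projResid (Matrix.fromCols A D) X with hRdef
    have hfc : ∀ w : Fin T ⊕ Fin l.m → ℝ, X - Matrix.fromCols A D *ᵥ w
        = X - A *ᵥ (w ∘ Sum.inl) - D *ᵥ (w ∘ Sum.inr) := fun w => by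
      rw [Matrix.fromCols_mulVec, sub_sub]
    rw [hfc] at hmin
    set s₀ := w ∘ Sum.inl with hs₀
    set u₀ := w ∘ Sum.inr with hu₀
    have hRX : R ≤ X ⬝ᵥ X := by simpa using hall 0
    have hRQ : R ≤ Q := by
      have := hall (Sum.elim s₁ u₁)
      rw [hfc, Sum.elim_comp_inl, Sum.elim_comp_inr] at this
      exact this.trans hge
    have hQR : Q ≤ R + ν⁻¹ * (u₀ ⬝ᵥ u₀) := by rw [hmin]; exact hle s₀ u₀
    -- The filter has leading coefficient `1`, so its coefficient vector has squared length at least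
    -- one in the nondegeneracy bound.
    have hκR : κ * N ≤ R := by
      rw [hmin, hR]
      refine le_trans ?_ (hx.lower c s₀ u₀)
      have h1 : c 0 ^ 2 ≤ ∑ i ∈ Finset.range (p + 1), c i ^ 2 :=
        Finset.single_le_sum (f := fun i => c i ^ 2) (fun _ _ => sq_nonneg _) (by simp)
      have h2 : c 0 = 1 := rfl
      rw [h2, one_pow] at h1
      exact le_mul_of_one_le_right (by positivity) h1
    have hXX : X ⬝ᵥ X ≤ (p + 1) ^ 2 * C ^ 2 * G * N := by
      have h1 := hR 0 0
      simp only [mulVec_zero, sub_zero, fitted_zero] at h1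
      rw [h1]
      refine (sum_lagSum_sq_le hCb x).trans ?_
      rw [mul_assoc _ G]
      exact mul_le_mul_of_nonneg_left hx.upper (by positivity)
    -- The fitted vector is `X` minus its residual, so its energy is at most `4 |X|² = O(N)`, while
    -- the design bound makes it at least `η ρ N |u₀|²`.
    have hu : u₀ ⬝ᵥ u₀ ≤ 4 * ((p + 1) ^ 2 * C ^ 2 * G) / (η * ρ) := by
      have h1 := hlow s₀ u₀
      rw [← hF] at h1
      set f := A *ᵥ s₀ + D *ᵥ u₀ with hf
      have h2 : f = X - (X - A *ᵥ s₀ - D *ᵥ u₀) := by rw [hf]; abel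
      have h3 : f ⬝ᵥ f ≤ 2 * (X ⬝ᵥ X) + 2 * R := by
        rw [hmin, h2]
        simp only [dotProduct, Finset.mul_sum, ← Finset.sum_add_distrib, Pi.sub_apply]
        refine Finset.sum_le_sum fun k _ => ?_
        nlinarith [sq_nonneg (X k + (X k - (A *ᵥ s₀) k - (D *ᵥ u₀) k))]
      have h4 : u₀ ⬝ᵥ u₀ ≤ ∑ v, s₀ v ^ 2 + ∑ r, u₀ r ^ 2 := by
        have : 0 ≤ ∑ v, s₀ v ^ 2 := Finset.sum_nonneg fun _ _ => sq_nonneg _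
        simp only [dotProduct, ← sq]
        linarith
      have h5 : η * ρ * N * (u₀ ⬝ᵥ u₀) ≤ 4 * ((p + 1) ^ 2 * C ^ 2 * G) * N :=
        (mul_le_mul_of_nonneg_left h4 hηρN.le).trans (by linarith)
      rw [le_div_iff₀ (by positivity)]
      refine le_of_mul_le_mul_right ?_ hN'
      linarith
    have hQR' : Q ≤ R + K₁ := by
      refine hQR.trans ?_
      have := mul_le_mul_of_nonneg_left hu (inv_pos.2 hν).le
      linarith
    have hRpos : 0 < R := (by positivity : 0 < κ * N).trans_le hκR
    have hσ : sigmaSqHat p T ν l N x = ((N : ℝ) - p)⁻¹ * Q := rfl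
    have hσ' : sigmaSqHatInf p T l N x = ((N : ℝ) - p)⁻¹ * R := rfl
    rw [hσ, hσ', Real.log_mul (inv_pos.2 hn).ne' (hRpos.trans_le hRQ).ne',
      Real.log_mul (inv_pos.2 hn).ne' hRpos.ne', ← mul_sub, add_sub_add_left_eq_sub]
    have hlog0 : 0 ≤ Real.log Q - Real.log R := sub_nonneg.2 (Real.log_le_log hRpos hRQ)
    -- By `log x ≤ x - 1`, a gap of at most `K₁` over a minimum of order `N` costs `O(1/N)`, which
    -- the prefactor `(N-p)/2` turns into `O(1)`.
    have hlog1 : Real.log Q - Real.log R ≤ K₁ / (κ * N) := by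
      rw [← Real.log_div (hRpos.trans_le hRQ).ne' hRpos.ne']
      have h1 := Real.log_le_sub_one_of_pos (div_pos (hRpos.trans_le hRQ) hRpos)
      have h2 : Q / R - 1 ≤ K₁ / R := by
        rw [div_sub_one hRpos.ne']
        gcongr
        linarith
      have h3 : K₁ / R ≤ K₁ / (κ * N) := by gcongr
      linarith
    rw [abs_of_nonneg (mul_nonneg (by positivity) hlog0)]
    calc ((N : ℝ) - p) / 2 * (Real.log Q - Real.log R) ≤ N / 2 * (K₁ / (κ * N)) := by
          refine mul_le_mul ?_ hlog1 hlog0 (by positivity)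
          linarith [Nat.cast_nonneg (α := ℝ) p]
      _ = K₁ / (2 * κ) := by field_simp
  · refine le_trans ?_ (le_max_right _ _)
    have hG' : ridgeGram p T ν l N x = ridge D ν := rfl
    rw [hG']
    have hDq : ∀ u, (D *ᵥ u) ⬝ᵥ (D *ᵥ u)
        = ∑ t ∈ Finset.Icc (p + 1) N, lagSum p c (fitted T l N 0 u) t ^ 2 := fun u => by
      rw [← hF, mulVec_zero, zero_add]
    have hνp := inv_pos.2 hν
    have huu : ∀ u : Fin l.m → ℝ, 0 ≤ u ⬝ᵥ u := fun u =>
      Finset.sum_nonneg fun _ _ => mul_self_nonneg _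
    obtain ⟨hd1, hd2⟩ := det_bounds_of_quadForm (R := ridge D ν) (ridge_posDef D hν).isHermitian
      (α := η * ρ * N) (β := β * N) hηρN.le
      (fun u => by
        rw [dotProduct_ridge, hDq]
        have h1 := hlow 0 u
        have h2 : ∑ v : Fin T, (0 : Fin T → ℝ) v ^ 2 + ∑ r, u r ^ 2 = u ⬝ᵥ u := by
          simp [dotProduct, sq]
        rw [h2] at h1
        have := mul_nonneg hνp.le (huu u)
        linarith)
      (fun u => by
        rw [dotProduct_ridge, hDq]
        have h1 := (sum_lagSum_sq_le hCb (N := N) (fitted T l N 0 u)).trans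
          (mul_le_mul_of_nonneg_left (sum_sq_fitted_le u) (by positivity))
        have h2 : ν⁻¹ * (u ⬝ᵥ u) ≤ ν⁻¹ * N * (u ⬝ᵥ u) := by
          have := huu u
          gcongr
          exact le_mul_of_one_le_right hνp.le hN1'
        rw [hβ]
        linarith)
    rw [mul_pow] at hd1 hd2
    have h1 := abs_log_sub_log_le (pow_pos hN' l.m) (by positivity) hd1 hd2
    rw [Real.log_pow] at h1
    have h2 := hlen N hN2
    rw [abs_sub_comm] at h2
    calc _ ≤ |Real.log (ridge D ν).det - l.m * Real.log N|
          + |l.m * Real.log N - ∑ r ∈ Finset.Icc 2 (l.m + 1), Real.log (l.regimeLen N r)| :=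
          abs_sub_le _ _ _
      _ ≤ _ := add_le_add h1 h2

/-! ### The prior terms -/

/-- The recursion `Γ(y+1) = y Γ(y)` is applied `k` times; each factor `y` lies between `α N / 2` and
`(β + b) N`, so each step costs `log N` up to the constant `L`. -/
lemma log_Gamma_sub_nat_bound {b α β : ℝ} (hb : 0 < b) (hα : 0 < α) (m : ℕ) :
    ∃ K : ℝ, ∃ N₀ : ℕ, ∀ N ≥ N₀, ∀ n : ℕ, α * N ≤ n → (n : ℝ) ≤ β * N → m ≤ n ∧ ∀ k ≤ m,
      |Real.log (Real.Gamma (b + n - k)) - Real.log (Real.Gamma (b + n)) + k * Real.log N| ≤ K := by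
  set L := |Real.log (α / 2)| + |Real.log (β + b)| with hL
  have hL0 : 0 ≤ L := by positivity
  refine ⟨m * L, ⌈2 * m / α⌉₊ + 1, fun N hN n hn1 hn2 => ?_⟩
  have hN1 : (1 : ℝ) ≤ N := by exact_mod_cast (show 1 ≤ N by omega)
  have hNα : 2 * m ≤ α * N := by
    have := (Nat.le_ceil (2 * m / α)).trans
      (Nat.cast_le (α := ℝ).2 (show ⌈2 * m / α⌉₊ ≤ N by omega))
    rwa [div_le_iff₀ hα, mul_comm (N : ℝ)] at this
  have hm0 : (0 : ℝ) ≤ m := Nat.cast_nonneg m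
  have hmn : m ≤ n := by
    have : (m : ℝ) ≤ n := by linarith
    exact_mod_cast this
  have key : ∀ k ≤ m, |Real.log (Real.Gamma (b + n - k)) - Real.log (Real.Gamma (b + n))
      + k * Real.log N| ≤ k * L := by
    intro k
    induction k with
    | zero => simp
    | succ k ih =>
      intro hk
      have ih := ih (by omega)
      have hkm : (k : ℝ) + 1 ≤ m := by exact_mod_cast hk
      have hk0 : (0 : ℝ) ≤ k := Nat.cast_nonneg k
      set y : ℝ := b + n - (k + 1) with hy
      have hylow : α / 2 * N ≤ y := by linarith
      have hypos : 0 < y := by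
        have : 0 < α / 2 * N := by positivity
        linarith
      have hyup : y ≤ (β + b) * N := by nlinarith
      have hG : Real.Gamma (b + n - k) = y * Real.Gamma y := by
        rw [← Real.Gamma_add_one hypos.ne', hy]
        congr 1; ring
      rw [hG, Real.log_mul hypos.ne' (Real.Gamma_pos_of_pos hypos).ne'] at ih
      have hlog := abs_log_sub_log_le (by linarith : (0 : ℝ) < N) (by positivity) hylow hyup
      push_cast
      rw [← hy]
      have : Real.log (Real.Gamma y) - Real.log (Real.Gamma (b + n)) + (k + 1) * Real.log N
          = (Real.log y + Real.log (Real.Gamma y) - Real.log (Real.Gamma (b + n))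
            + k * Real.log N) - (Real.log y - Real.log N) := by ring
      rw [this]
      refine (abs_sub _ _).trans ?_
      linarith
  refine ⟨hmn, fun k hk => (key k hk).trans ?_⟩
  have : (k : ℝ) ≤ m := by exact_mod_cast hk
  gcongr

lemma mUndoc_add_mDoc (l : RelConfig) (N : ℕ) (doc : Finset ℕ) :
    l.mUndoc N doc + l.mDoc N doc = l.m := by
  unfold RelConfig.mUndoc RelConfig.mDoc
  rw [add_comm]
  have := Finset.card_filter_add_card_filter_not (s := Finset.Icc 1 l.m)
    (fun r => l.tau N r ∈ doc)
  rw [this, Nat.card_Icc]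
  omega

lemma eventually_bounds_of_isTheta {n : ℕ → ℕ}
    (h : (fun N => (n N : ℝ)) =Θ[atTop] fun N : ℕ => (N : ℝ)) :
    ∃ α : ℝ, 0 < α ∧ ∃ β : ℝ, ∀ᶠ N : ℕ in atTop, α * N ≤ n N ∧ (n N : ℝ) ≤ β * N := by
  obtain ⟨c, -, hc'⟩ := h.1.exists_pos
  obtain ⟨c₂, hc₂, hc₂'⟩ := h.2.exists_pos
  refine ⟨c₂⁻¹, inv_pos.2 hc₂, c, ?_⟩
  filter_upwards [hc'.bound, hc₂'.bound] with N h1 h2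
  simp only [Real.norm_natCast] at h1 h2
  refine ⟨?_, h1⟩
  rw [inv_mul_le_iff₀ hc₂]
  exact h2

/-- The normalising constant: it depends only on the hyper-parameters, the documented times
and `N`. -/
def normConst (p : ℕ) (b₁ b₂ : ℝ) (doc : ℕ → Finset ℕ) (N : ℕ) : ℝ :=
  -Real.log (Real.Gamma (b₁ + nUndoc p N (doc N))) - Real.log (Real.Gamma (b₂ + nDoc p N (doc N)))
    - Real.log N

lemma log_Gamma_counts_bound {p : ℕ} {b₁ b₂ : ℝ} (hb₁ : 0 < b₁) (hb₂ : 0 < b₂)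
    {doc : ℕ → Finset ℕ}
    (hdoc : (∀ N, doc N = ∅) ∨
      (((fun N => (nUndoc p N (doc N) : ℝ)) =Θ[atTop] fun N : ℕ => (N : ℝ)) ∧
       ((fun N => (nDoc p N (doc N) : ℝ)) =Θ[atTop] fun N : ℕ => (N : ℝ)))) (l : RelConfig) :
    ∃ K : ℝ, ∀ᶠ N : ℕ in atTop,
      (l.mUndoc N (doc N) ≤ nUndoc p N (doc N) ∧
        |Real.log (Real.Gamma (b₁ + nUndoc p N (doc N) - l.mUndoc N (doc N)))
          - Real.log (Real.Gamma (b₁ + nUndoc p N (doc N)))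
          + l.mUndoc N (doc N) * Real.log N| ≤ K) ∧
      (l.mDoc N (doc N) ≤ nDoc p N (doc N) ∧
        |Real.log (Real.Gamma (b₂ + nDoc p N (doc N) - l.mDoc N (doc N)))
          - Real.log (Real.Gamma (b₂ + nDoc p N (doc N)))
          + l.mDoc N (doc N) * Real.log N| ≤ K) := by
  have hm : ∀ N, l.mUndoc N (doc N) ≤ l.m ∧ l.mDoc N (doc N) ≤ l.m := fun N => by
    have := mUndoc_add_mDoc l N (doc N)
    omega
  rcases hdoc with h | ⟨h1, h2⟩
  · obtain ⟨K, N₀, hK⟩ := log_Gamma_sub_nat_bound hb₁ (α := 1 / 2) (β := 1) (by norm_num)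
      l.m
    refine ⟨max K 0, ?_⟩
    filter_upwards [eventually_ge_atTop N₀, eventually_ge_atTop (2 * p)] with N hN hNp
    -- Without metadata every time is undocumented, so this count is at least `N / 2` for `N ≥ 2p`,
    -- and the documented Gamma factor is constant.
    have hn : nUndoc p N (doc N) = N - p := by simp [nUndoc, h N]
    have hNp' : 2 * (p : ℝ) ≤ N := by exact_mod_cast hNp
    have hcast : ((N - p : ℕ) : ℝ) = N - p := by rw [Nat.cast_sub (by omega)]
    obtain ⟨hle, hK'⟩ := hK N hN (N - p) (by rw [hcast]; linarith)
      (by rw [hcast]; linarith [Nat.cast_nonneg (α := ℝ) p])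
    rw [hn]
    refine ⟨⟨(hm N).1.trans hle, (hK' _ (hm N).1).trans (le_max_left _ _)⟩, ?_⟩
    have hmd : l.mDoc N (doc N) = 0 := by simp [RelConfig.mDoc, h N]
    rw [hmd]
    simp
  · obtain ⟨α₁, hα₁, β₁, hb1⟩ := eventually_bounds_of_isTheta h1
    obtain ⟨α₂, hα₂, β₂, hb2⟩ := eventually_bounds_of_isTheta h2
    obtain ⟨K₁, N₁, hK₁⟩ := log_Gamma_sub_nat_bound (β := β₁) hb₁ hα₁ l.m
    obtain ⟨K₂, N₂, hK₂⟩ := log_Gamma_sub_nat_bound (β := β₂) hb₂ hα₂ l.m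
    refine ⟨max K₁ K₂, ?_⟩
    filter_upwards [eventually_ge_atTop N₁, eventually_ge_atTop N₂, hb1, hb2] with N hN1 hN2 e1 e2
    obtain ⟨hle1, hg1⟩ := hK₁ N hN1 _ e1.1 e1.2
    obtain ⟨hle2, hg2⟩ := hK₂ N hN2 _ e2.1 e2.2
    exact ⟨⟨(hm N).1.trans hle1, (hg1 _ (hm N).1).trans (le_max_left _ _)⟩,
      (hm N).2.trans hle2, (hg2 _ (hm N).2).trans (le_max_right _ _)⟩

/-- The prior terms of the two criteria differ by the normalising constant, up to `O(1)`. -/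
theorem prior_comparison {p : ℕ} {a b₁ b₂ : ℝ} (ha : 0 < a) (hb₁ : 0 < b₁) (hb₂ : 0 < b₂)
    {doc : ℕ → Finset ℕ}
    (hdoc : (∀ N, doc N = ∅) ∨
      (((fun N => (nUndoc p N (doc N) : ℝ)) =Θ[atTop] fun N : ℕ => (N : ℝ)) ∧
       ((fun N => (nDoc p N (doc N) : ℝ)) =Θ[atTop] fun N : ℕ => (N : ℝ)))) (l : RelConfig) :
    ∃ K : ℝ, ∀ᶠ N : ℕ in atTop,
      |-(Real.log (Real.Gamma (a + l.mUndoc N (doc N)) *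
            Real.Gamma (b₁ + nUndoc p N (doc N) - l.mUndoc N (doc N)))
          + Real.log (Real.Gamma (a + l.mDoc N (doc N)) *
            Real.Gamma (b₂ + nDoc p N (doc N) - l.mDoc N (doc N))))
        - ((l.m : ℝ) + 1) * Real.log ((N : ℝ) - p) - normConst p b₁ b₂ doc N| ≤ K := by
  obtain ⟨K, hK⟩ := log_Gamma_counts_bound hb₁ hb₂ hdoc l
  -- The split of `m` into documented and undocumented changepoints may vary with `N`; `S` bounds
  -- `log Γ(a + k)` for every possible count at once.
  set S := ∑ k ∈ Finset.range (l.m + 1), |Real.log (Real.Gamma (a + k))| with hS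
  have hSk : ∀ k ≤ l.m, |Real.log (Real.Gamma (a + k))| ≤ S := fun k hk =>
    Finset.single_le_sum (f := fun k : ℕ => |Real.log (Real.Gamma (a + k))|)
      (fun _ _ => abs_nonneg _) (Finset.mem_range.2 (by omega))
  refine ⟨2 * S + 2 * K + (l.m + 1) * (|Real.log (1 / 2)| + |Real.log 1|), ?_⟩
  filter_upwards [hK, eventually_ge_atTop (2 * p + 1)] with N ⟨⟨hle1, hg1⟩, hle2, hg2⟩ hN
  have hadd := mUndoc_add_mDoc l N (doc N)
  have hs1 := hSk _ (show l.mUndoc N (doc N) ≤ l.m by omega)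
  have hs2 := hSk _ (show l.mDoc N (doc N) ≤ l.m by omega)
  have hadd' : (l.m : ℝ) = l.mUndoc N (doc N) + l.mDoc N (doc N) := by exact_mod_cast hadd.symm
  have hpos : ∀ {b : ℝ} {n k : ℕ}, 0 < b → k ≤ n → 0 < Real.Gamma (b + n - k) :=
    fun {b n k} hb hk => Real.Gamma_pos_of_pos (by
      have : (k : ℝ) ≤ n := by exact_mod_cast hk
      linarith)
  have hposa : ∀ k : ℕ, 0 < Real.Gamma (a + k) := fun k => Real.Gamma_pos_of_pos (by positivity)
  rw [Real.log_mul (hposa _).ne' (hpos hb₁ hle1).ne', Real.log_mul (hposa _).ne'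
    (hpos hb₂ hle2).ne', normConst]
  have hN' : 2 * (p : ℝ) + 1 ≤ N := by exact_mod_cast hN
  have hp0 : (0 : ℝ) ≤ p := Nat.cast_nonneg p
  have hlog := abs_log_sub_log_le (a := (N : ℝ) - p) (b := N) (α := 1 / 2) (β := 1)
    (by linarith) (by norm_num) (by linarith) (by linarith)
  generalize l.mUndoc N (doc N) = m₁ at *
  generalize l.mDoc N (doc N) = m₂ at *
  generalize nUndoc p N (doc N) = n₁ at *
  generalize nDoc p N (doc N) = n₂ at *
  have hprod : |((l.m : ℝ) + 1) * (Real.log ((N : ℝ) - p) - Real.log N)|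
      ≤ (l.m + 1) * (|Real.log (1 / 2)| + |Real.log 1|) := by
    rw [abs_mul, abs_of_nonneg (by positivity : (0 : ℝ) ≤ (l.m : ℝ) + 1)]
    gcongr
  generalize |Real.log (1 / 2)| + |Real.log 1| = B at *
  have hexp : ((l.m : ℝ) + 1) * (Real.log ((N : ℝ) - p) - Real.log N)
      = ((l.m : ℝ) + 1) * Real.log ((N : ℝ) - p) - (m₁ * Real.log N + m₂ * Real.log N + Real.log N)
      := by
    rw [mul_sub, hadd']; ring
  rw [hexp] at hprod
  rw [abs_le] at *
  constructor <;> linarith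

/-! ### Second moments of the noise -/

section Noise

variable {Ω : Type*} [MeasurableSpace Ω] {P : Measure Ω}

lemma integral_sum_sq_of_orthogonal {ι : Type*} [DecidableEq ι] {Y : ι → Ω → ℝ} {v : ℝ}
    (s : Finset ι) (b : ι → ℝ) (hL : ∀ i ∈ s, MemLp (Y i) 2 P)
    (hY : ∀ i ∈ s, ∀ j ∈ s, ∫ ω, Y i ω * Y j ω ∂P = if i = j then v else 0) :
    Integrable (fun ω => (∑ i ∈ s, b i * Y i ω) ^ 2) P ∧
      ∫ ω, (∑ i ∈ s, b i * Y i ω) ^ 2 ∂P = v * ∑ i ∈ s, b i ^ 2 := by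
  have hexp : (fun ω => (∑ i ∈ s, b i * Y i ω) ^ 2)
      = fun ω => ∑ i ∈ s, ∑ j ∈ s, b i * b j * (Y i ω * Y j ω) := by
    funext ω
    rw [sq, Finset.sum_mul_sum]
    exact Finset.sum_congr rfl fun i _ => Finset.sum_congr rfl fun j _ => by ring
  have hInt : ∀ i ∈ s, ∀ j ∈ s, Integrable (fun ω => b i * b j * (Y i ω * Y j ω)) P :=
    fun i hi j hj => ((hL i hi).integrable_mul (hL j hj)).const_mul _
  rw [hexp]
  refine ⟨integrable_finsetSum _ fun i hi => integrable_finsetSum _ fun j hj => hInt i hi j hj, ?_⟩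
  rw [integral_finsetSum _ fun i hi => integrable_finsetSum _ fun j hj => hInt i hi j hj,
    Finset.mul_sum]
  refine Finset.sum_congr rfl fun i hi => ?_
  rw [integral_finsetSum _ fun j hj => hInt i hi j hj]
  simp only [integral_const_mul]
  rw [Finset.sum_congr rfl fun j hj => by rw [hY i hi j hj]]
  simp [hi]
  ring

variable {p : ℕ} {φ : Fin p → ℝ} {σ : ℝ} {Z ε : ℤ → Ω → ℝ}

namespace IsCausalAR

lemma memLp_noise (h : IsCausalAR P φ σ Z ε) (t : ℤ) : MemLp (Z t) 2 P :=
  (h.ident t).memLp_iff.2 h.memLp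

lemma aemeasurable_noise (h : IsCausalAR P φ σ Z ε) (t : ℤ) : AEMeasurable (Z t) P :=
  (h.ident t).aemeasurable_fst

lemma integral_noise (h : IsCausalAR P φ σ Z ε) (t : ℤ) : ∫ ω, Z t ω ∂P = 0 := by
  rw [(h.ident t).integral_eq, h.mean_zero]

lemma integral_noise_sq (h : IsCausalAR P φ σ Z ε) (t : ℤ) : ∫ ω, Z t ω ^ 2 ∂P = σ ^ 2 := by
  have h1 := variance_of_integral_eq_zero (h.aemeasurable_noise t) (h.integral_noise t)
  rw [← h1, (h.ident t).variance_eq, h.variance_eq]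

lemma integral_noise_mul (h : IsCausalAR P φ σ Z ε) (s t : ℤ) :
    ∫ ω, Z s ω * Z t ω ∂P = if s = t then σ ^ 2 else 0 := by
  split_ifs with hst
  · subst hst
    simp only [← sq]
    exact h.integral_noise_sq s
  · rw [(h.indep.indepFun hst).integral_fun_mul_eq_mul_integral
      (h.memLp_noise s).1 (h.memLp_noise t).1, h.integral_noise, zero_mul]

/-- Second moment of a linear combination of the noise at distinct times. -/
lemma integral_noise_sum_sq (h : IsCausalAR P φ σ Z ε) {ι : Type*} (s : Finset ι) (b : ι → ℝ)
    {τ : ι → ℤ} (hτ : Function.Injective τ) :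
    Integrable (fun ω => (∑ i ∈ s, b i * Z (τ i) ω) ^ 2) P ∧
      ∫ ω, (∑ i ∈ s, b i * Z (τ i) ω) ^ 2 ∂P = σ ^ 2 * ∑ i ∈ s, b i ^ 2 := by
  classical
  refine integral_sum_sq_of_orthogonal (Y := fun i => Z (τ i)) s b
    (fun i _ => h.memLp_noise _) fun i _ j _ => ?_
  rw [h.integral_noise_mul]
  simp [hτ.eq_iff]

/-- Independence gives the product a finite second moment from those of the factors; no fourth
moment of the noise is required. -/
lemma memLp_noise_mul (h : IsCausalAR P φ σ Z ε) {s t : ℤ} (hst : s ≠ t) :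
    MemLp (fun ω => Z s ω * Z t ω) 2 P := by
  refine (memLp_two_iff_integrable_sq ((h.memLp_noise s).1.mul (h.memLp_noise t).1)).2 ?_
  have h1 := (((h.indep.indepFun hst).comp (measurable_id.pow_const 2)
    (measurable_id.pow_const 2))).integrable_mul (h.memLp_noise s).integrable_sq
    (h.memLp_noise t).integrable_sq
  refine h1.congr (ae_of_all _ fun ω => ?_)
  simp [mul_pow]

lemma integral_noise_mul_sq (h : IsCausalAR P φ σ Z ε) {s t : ℤ} (hst : s ≠ t) :
    ∫ ω, (Z s ω * Z t ω) * (Z s ω * Z t ω) ∂P = σ ^ 4 := by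
  have h1 := (((h.indep.indepFun hst).comp (measurable_id.pow_const 2)
    (measurable_id.pow_const 2))).integral_fun_mul_eq_mul_integral
    (h.memLp_noise s).integrable_sq.1 (h.memLp_noise t).integrable_sq.1
  have h2 : ∀ ω, (Z s ω * Z t ω) * (Z s ω * Z t ω)
      = ((fun x : ℝ => id x ^ 2) ∘ Z s) ω * ((fun x : ℝ => id x ^ 2) ∘ Z t) ω := fun ω => by
    simp only [Function.comp, id]; ring
  simp only [h2]
  rw [h1]
  simp only [Function.comp_def, id, h.integral_noise_sq]
  ring

/-- If the time `t` occurs once among four, the fourth mixed moment vanishes. -/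
lemma integral_noise_mul_mul (h : IsCausalAR P φ σ Z ε) {t u v w : ℤ} (hu : t ≠ u) (hv : t ≠ v)
    (hw : t ≠ w) : ∫ ω, (Z t ω * Z u ω) * (Z v ω * Z w ω) ∂P = 0 := by
  have hind := h.indep.indepFun_finset₀ {t} {u, v, w} (by simp [hu, hv, hw]) h.aemeasurable_noise
  have hm₁ : Measurable fun f : (({t} : Finset ℤ) → ℝ) => f ⟨t, by simp⟩ :=
    measurable_pi_apply _
  have hm₂ : Measurable fun f : (({u, v, w} : Finset ℤ) → ℝ) =>
      f ⟨u, by simp⟩ * (f ⟨v, by simp⟩ * f ⟨w, by simp⟩) := by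
    refine Measurable.mul ?_ (Measurable.mul ?_ ?_) <;> exact measurable_pi_apply _
  have hcomp := hind.comp hm₁ hm₂
  have h1 := hcomp.integral_fun_mul_eq_mul_integral (h.memLp_noise t).1
    ((h.memLp_noise u).1.mul ((h.memLp_noise v).1.mul (h.memLp_noise w).1))
  simp only [Function.comp_def] at h1
  simp only [mul_assoc]
  rw [h1, h.integral_noise, zero_mul]

/-- Second moment of a sum of lagged products of the noise. -/
lemma integral_noise_lag_sum_sq (h : IsCausalAR P φ σ Z ε) {ι : Type*} (s : Finset ι)
    {τ : ι → ℤ} (hτ : Function.Injective τ) {k : ℤ} (hk : 0 < k) :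
    Integrable (fun ω => (∑ i ∈ s, Z (τ i) ω * Z (τ i - k) ω) ^ 2) P ∧
      ∫ ω, (∑ i ∈ s, Z (τ i) ω * Z (τ i - k) ω) ^ 2 ∂P = σ ^ 4 * s.card := by
  classical
  have := integral_sum_sq_of_orthogonal (P := P) (v := σ ^ 4)
    (Y := fun i ω => Z (τ i) ω * Z (τ i - k) ω) s 1
    (fun i _ => h.memLp_noise_mul (by omega)) fun i _ j _ => by
      split_ifs with hij
      · subst hij
        exact h.integral_noise_mul_sq (by omega)
      -- As `k > 0`, the later of the two distinct leading times occurs only once among the four.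
      · rcases lt_or_gt_of_ne (hτ.ne hij) with hlt | hgt
        · simp only [mul_comm (Z (τ i) _ * Z (τ i - k) _)]
          exact h.integral_noise_mul_mul (by omega) (by omega) (by omega)
        · exact h.integral_noise_mul_mul (by omega) (by omega) (by omega)
  simpa using this

/-- Law of large numbers for the squared noise. -/
lemma tendsto_noise_sq (h : IsCausalAR P φ σ Z ε) (t₀ : ℤ) :
    ∀ᵐ ω ∂P, Tendsto (fun n : ℕ => (∑ k ∈ Finset.range n, Z (t₀ + k) ω ^ 2) / n) atTop
      (nhds (σ ^ 2)) := by
  have hm : Measurable fun x : ℝ => x ^ 2 := measurable_id.pow_const 2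
  have := strong_law_ae_real (μ := P) (fun k : ℕ => fun ω => Z (t₀ + k) ω ^ 2)
    (h.memLp_noise _).integrable_sq
    (fun i j hij => (h.indep.indepFun (by simpa using hij)).comp hm hm)
    (fun i => (((h.ident _).trans (h.ident _).symm).comp hm))
  simp only [h.integral_noise_sq] at this
  exact this

end IsCausalAR

end Noise

/-! ### Asymptotic orthogonality of the lagged noise vectors -/

section Events

variable {Ω : Type*} [MeasurableSpace Ω] {P : Measure Ω} [IsProbabilityMeasure P]

/-- Markov's inequality for a sequence bounded in mean against linear thresholds. -/
lemma tendsto_measure_linear_le {f : ℕ → Ω → ℝ} {C η : ℝ} (hη : 0 < η) (h0 : ∀ N ω, 0 ≤ f N ω)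
    (hInt : ∀ N, Integrable (f N) P) (hC : ∀ N, ∫ ω, f N ω ∂P ≤ C) :
    Tendsto (fun N : ℕ => P {ω | η * N ≤ f N ω}) atTop (nhds 0) := by
  have hlim : Tendsto (fun N : ℕ => ENNReal.ofReal (C / η / N)) atTop (nhds 0) := by
    have := ENNReal.tendsto_ofReal (tendsto_const_div_atTop_nhds_zero_nat (C / η))
    simpa using this
  refine tendsto_of_tendsto_of_tendsto_of_le_of_le' tendsto_const_nhds hlim
    (Eventually.of_forall fun _ => zero_le) ?_
  filter_upwards [eventually_gt_atTop 0] with N hN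
  have hN' : (0 : ℝ) < N := by exact_mod_cast hN
  have h1 := mul_meas_ge_le_integral_of_nonneg (ae_of_all P (h0 N)) (hInt N) (η * N)
  rw [← ofReal_measureReal (measure_ne_top P _)]
  refine ENNReal.ofReal_le_ofReal ?_
  rw [div_div, le_div_iff₀ (by positivity), mul_comm]
  exact h1.trans (hC N)

variable {p : ℕ} {φ : Fin p → ℝ} {σ : ℝ} {Z ε : ℤ → Ω → ℝ}

/-- The noise at the times `2 p + 1 - i, …, N - i`. -/
def noiseVec {Ω : Type*} (p : ℕ) (Z : ℤ → Ω → ℝ) (N i : ℕ) (ω : Ω) : EuclideanSpace ℝ (Fin (N - 2 * p)) :=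
  WithLp.toLp 2 fun k => Z (2 * p + 1 + k - i) ω

lemma inner_noiseVec {Ω : Type*} {Z : ℤ → Ω → ℝ} (N i j : ℕ) (ω : Ω) :
    inner ℝ (noiseVec p Z N i ω) (noiseVec p Z N j ω)
      = ∑ k : Fin (N - 2 * p), Z (2 * p + 1 + k - i) ω * Z (2 * p + 1 + k - j) ω := by
  simp [noiseVec, PiLp.inner_apply, mul_comm]

namespace IsCausalAR

/-- Chebyshev's inequality: products at a fixed nonzero lag are orthogonal, so the inner product has
second moment at most `σ⁴ N`, against a squared threshold of order `N²`. -/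
lemma tendsto_measure_inner_noiseVec_of_lt (h : IsCausalAR P φ σ Z ε) {i j : ℕ} (hij : i < j)
    {η : ℝ} (hη : 0 < η) :
    Tendsto (fun N : ℕ => P {ω | η * N ≤ |inner ℝ (noiseVec p Z N i ω) (noiseVec p Z N j ω)|})
      atTop (nhds 0) := by
  have hinner : ∀ N ω, inner ℝ (noiseVec p Z N i ω) (noiseVec p Z N j ω)
      = ∑ k : Fin (N - 2 * p), Z (2 * p + 1 + k - i) ω *
        Z (2 * p + 1 + k - i - (j - i : ℤ)) ω := fun N ω => by
    rw [inner_noiseVec]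
    refine Finset.sum_congr rfl fun k _ => ?_
    congr 2; ring
  have hmom := fun N : ℕ => h.integral_noise_lag_sum_sq (Finset.univ : Finset (Fin (N - 2 * p)))
    (τ := fun k => 2 * p + 1 + k - i) (fun a b hab => by
      simp only at hab; exact Fin.ext (by omega)) (k := (j - i : ℤ)) (by omega)
  simp only [← hinner] at hmom
  have hlim := tendsto_measure_linear_le (P := P) (η := η ^ 2) (C := σ ^ 4)
    (f := fun N ω => (inner ℝ (noiseVec p Z N i ω) (noiseVec p Z N j ω)) ^ 2 / N) (by positivity)
    (fun N ω => by positivity) (fun N => (hmom N).1.div_const _) (fun N => by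
      rw [integral_div, (hmom N).2, Finset.card_univ, Fintype.card_fin]
      refine div_le_of_le_mul₀ (Nat.cast_nonneg _) (by positivity) ?_
      gcongr
      omega)
  refine tendsto_of_tendsto_of_tendsto_of_le_of_le' tendsto_const_nhds hlim
    (Eventually.of_forall fun _ => zero_le) ?_
  filter_upwards [eventually_gt_atTop 0] with N hN
  have hN' : (0 : ℝ) < N := by exact_mod_cast hN
  refine measure_mono fun ω hω => ?_
  simp only [Set.mem_ofPred_eq] at hω ⊢
  rw [le_div_iff₀ hN', ← sq_abs (inner ℝ _ _)]
  calc η ^ 2 * N * N = (η * N) ^ 2 := by ring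
    _ ≤ _ := by gcongr

/-- Squared noise need not have a variance, so the strong law replaces Chebyshev here; almost sure
convergence is then weakened to convergence in measure. -/
lemma tendsto_measure_norm_noiseVec (h : IsCausalAR P φ σ Z ε) (i : ℕ) {η : ℝ} (hη : 0 < η) :
    Tendsto (fun N : ℕ => P {ω | η * N ≤
      |inner ℝ (noiseVec p Z N i ω) (noiseVec p Z N i ω) - σ ^ 2 * N|}) atTop (nhds 0) := by
  have hsum : ∀ N ω, inner ℝ (noiseVec p Z N i ω) (noiseVec p Z N i ω)
      = ∑ k ∈ Finset.range (N - 2 * p), Z (2 * p + 1 - i + k) ω ^ 2 := fun N ω => by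
    rw [inner_noiseVec, Finset.sum_range]
    refine Finset.sum_congr rfl fun k _ => ?_
    rw [← sq]
    congr 2; ring
  have hae : ∀ᵐ ω ∂P, Tendsto
      (fun N : ℕ => inner ℝ (noiseVec p Z N i ω) (noiseVec p Z N i ω) / N) atTop
      (nhds (σ ^ 2)) := by
    filter_upwards [h.tendsto_noise_sq (2 * p + 1 - i)] with ω hω
    have h1 := hω.comp (tendsto_sub_atTop_nat (2 * p))
    have h2 : Tendsto (fun N : ℕ => ((N - 2 * p : ℕ) : ℝ) / N) atTop (nhds 1) := by
      have h3 := (tendsto_const_div_atTop_nhds_zero_nat (2 * p : ℝ)).const_sub 1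
      rw [sub_zero] at h3
      refine h3.congr' ?_
      filter_upwards [eventually_gt_atTop (2 * p)] with N hN
      have hN' : (N : ℝ) ≠ 0 := by exact_mod_cast (show N ≠ 0 by omega)
      rw [Nat.cast_sub hN.le, sub_div, div_self hN']
      push_cast
      rfl
    have h3 := h1.mul h2
    rw [mul_one] at h3
    refine h3.congr' ?_
    filter_upwards [eventually_gt_atTop (2 * p)] with N hN
    have hN' : ((N - 2 * p : ℕ) : ℝ) ≠ 0 := by exact_mod_cast (show N - 2 * p ≠ 0 by omega)
    simp only [Function.comp]
    rw [hsum, div_mul_div_cancel₀ hN']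
  have hmeas : ∀ N : ℕ, AEStronglyMeasurable
      (fun ω => inner ℝ (noiseVec p Z N i ω) (noiseVec p Z N i ω) / (N : ℝ)) P := fun N => by
    simp only [hsum]
    exact ((Finset.aemeasurable_fun_sum _ fun k _ =>
      (h.aemeasurable_noise _).pow_const 2).div_const _).aestronglyMeasurable
  have hin := tendstoInMeasure_iff_norm.1 (tendstoInMeasure_of_tendsto_ae hmeas hae) η hη
  refine tendsto_of_tendsto_of_tendsto_of_le_of_le' tendsto_const_nhds hin
    (Eventually.of_forall fun _ => zero_le) ?_
  filter_upwards [eventually_gt_atTop 0] with N hN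
  have hN' : (0 : ℝ) < N := by exact_mod_cast hN
  refine measure_mono fun ω hω => ?_
  simp only [Set.mem_ofPred_eq] at hω ⊢
  rw [Real.norm_eq_abs, show inner ℝ (noiseVec p Z N i ω) (noiseVec p Z N i ω) / (N : ℝ) - σ ^ 2
    = (inner ℝ (noiseVec p Z N i ω) (noiseVec p Z N i ω) - σ ^ 2 * N) / N by field_simp, abs_div,
    abs_of_pos hN', le_div_iff₀ hN']
  exact hω

lemma tendsto_measure_gram_noiseVec (h : IsCausalAR P φ σ Z ε) (i j : ℕ) {η : ℝ} (hη : 0 < η) :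
    Tendsto (fun N : ℕ => P {ω | η * N ≤ |inner ℝ (noiseVec p Z N i ω) (noiseVec p Z N j ω)
      - if i = j then σ ^ 2 * N else 0|}) atTop (nhds 0) := by
  rcases lt_trichotomy i j with hij | rfl | hij
  · simp only [hij.ne, if_false, sub_zero]
    exact h.tendsto_measure_inner_noiseVec_of_lt hij hη
  · simp only [if_true]
    exact h.tendsto_measure_norm_noiseVec i hη
  · simp only [hij.ne', if_false, sub_zero, real_inner_comm (noiseVec p Z _ j _)]
    exact h.tendsto_measure_inner_noiseVec_of_lt hij hη

/-- In an orthonormal basis of the nonrandom subspace `W N` each noise coordinate has second moment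
`σ²`, so the projection has mean square `σ² dim (W N) ≤ σ² K`. -/
lemma tendsto_measure_proj_noiseVec (h : IsCausalAR P φ σ Z ε) (i : ℕ) {η : ℝ} (hη : 0 < η)
    (W : ∀ N : ℕ, Submodule ℝ (EuclideanSpace ℝ (Fin (N - 2 * p)))) {K : ℕ}
    (hW : ∀ N, Module.finrank ℝ (W N) ≤ K) :
    Tendsto (fun N : ℕ => P {ω | η * N ≤ ‖(W N).starProjection (noiseVec p Z N i ω)‖ ^ 2})
      atTop (nhds 0) := by
  have hnorm : ∀ N ω, ‖(W N).starProjection (noiseVec p Z N i ω)‖ ^ 2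
      = ∑ b, (∑ k, (stdOrthonormalBasis ℝ (W N) b : EuclideanSpace ℝ (Fin (N - 2 * p))) k *
        Z (2 * p + 1 + k - i) ω) ^ 2 := fun N ω => by
    have h1 := (stdOrthonormalBasis ℝ (W N)).sum_sq_norm_inner_right
      ((W N).orthogonalProjectionOnto (noiseVec p Z N i ω))
    have h2 : ‖(W N).starProjection (noiseVec p Z N i ω)‖
        = ‖(W N).orthogonalProjectionOnto (noiseVec p Z N i ω)‖ := rfl
    rw [h2, ← h1]
    refine Finset.sum_congr rfl fun b _ => ?_
    rw [Submodule.inner_orthogonalProjectionOnto_eq_of_mem_left, Real.norm_eq_abs, sq_abs]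
    congr 1
    simp [noiseVec, PiLp.inner_apply, mul_comm]
  have hmom := fun (N : ℕ) (b : Fin (Module.finrank ℝ (W N))) =>
    h.integral_noise_sum_sq (Finset.univ : Finset (Fin (N - 2 * p)))
    (fun k => (stdOrthonormalBasis ℝ (W N) b : EuclideanSpace ℝ (Fin (N - 2 * p))) k)
    (τ := fun k => 2 * p + 1 + k - i) (fun a b hab => by
      simp only at hab; exact Fin.ext (by omega))
  have hunit : ∀ (N : ℕ) (b : Fin (Module.finrank ℝ (W N))),
      ∑ k, (stdOrthonormalBasis ℝ (W N) b : EuclideanSpace ℝ (Fin (N - 2 * p))) k ^ 2 = 1 :=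
    fun N b => by
      have h1 := (stdOrthonormalBasis ℝ (W N)).orthonormal.1 b
      rw [Submodule.coe_norm] at h1
      have h2 := EuclideanSpace.norm_sq_eq
        (stdOrthonormalBasis ℝ (W N) b : EuclideanSpace ℝ (Fin (N - 2 * p)))
      rw [h1, one_pow] at h2
      simpa using h2.symm
  refine tendsto_measure_linear_le (C := σ ^ 2 * K) hη (fun _ _ => sq_nonneg _)
    (fun N => ?_) (fun N => ?_)
  · simp only [hnorm]
    exact integrable_finsetSum _ fun b _ => (hmom N b).1
  · simp only [hnorm]
    rw [integral_finsetSum _ fun b _ => (hmom N b).1,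
      Finset.sum_congr rfl fun b _ => (hmom N b).2]
    simp only [hunit, mul_one, Finset.sum_const, Finset.card_univ, Fintype.card_fin, nsmul_eq_mul]
    rw [mul_comm]
    gcongr
    exact hW N

end IsCausalAR

end Events

/-- A lower bound for combinations of nearly orthogonal vectors that are nearly orthogonal to
a subspace. -/
lemma nearly_orthogonal_lower_bound {E : Type*} [NormedAddCommGroup E] [InnerProductSpace ℝ E]
    (W : Submodule ℝ E) [W.HasOrthogonalProjection] {p : ℕ} {z : ℕ → E} {v η : ℝ} (hη : 0 ≤ η)
    (hz : ∀ i ≤ p, ∀ j ≤ p, |inner ℝ (z i) (z j) - if i = j then v else 0| ≤ η)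
    (hP : ∀ i ≤ p, ‖W.starProjection (z i)‖ ^ 2 ≤ η) (a : ℕ → ℝ) {w : E} (hw : w ∈ W) :
    (v - 2 * η * (p + 1)) * ∑ i ∈ Finset.range (p + 1), a i ^ 2
      ≤ ‖∑ i ∈ Finset.range (p + 1), a i • z i + w‖ ^ 2 := by
  set y := ∑ i ∈ Finset.range (p + 1), a i • z i with hy
  set S := ∑ i ∈ Finset.range (p + 1), |a i| with hS
  have hS0 : 0 ≤ S := Finset.sum_nonneg fun _ _ => abs_nonneg _
  have hSsq : S ^ 2 ≤ (p + 1) * ∑ i ∈ Finset.range (p + 1), a i ^ 2 := by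
    have := sq_sum_le_card_mul_sum_sq (s := Finset.range (p + 1)) (f := fun i => |a i|)
    simpa using this
  have hynorm : v * ∑ i ∈ Finset.range (p + 1), a i ^ 2 - η * S ^ 2 ≤ ‖y‖ ^ 2 := by
    have h1 : ‖y‖ ^ 2 = ∑ i ∈ Finset.range (p + 1), ∑ j ∈ Finset.range (p + 1),
        a i * a j * inner ℝ (z i) (z j) := by
      rw [← real_inner_self_eq_norm_sq, hy, sum_inner]
      refine Finset.sum_congr rfl fun i _ => ?_
      rw [inner_sum]
      refine Finset.sum_congr rfl fun j _ => ?_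
      rw [real_inner_smul_left, real_inner_smul_right]; ring
    have h2 : v * ∑ i ∈ Finset.range (p + 1), a i ^ 2 - η * S ^ 2
        = ∑ i ∈ Finset.range (p + 1), ∑ j ∈ Finset.range (p + 1),
          (a i * a j * (if i = j then v else 0) - |a i| * |a j| * η) := by
      simp only [Finset.sum_sub_distrib]
      congr 1
      · rw [Finset.mul_sum]
        refine Finset.sum_congr rfl fun i hi => ?_
        simp only [mul_ite, mul_zero, Finset.sum_ite_eq, hi, if_true]
        ring
      · rw [sq, hS, Finset.sum_mul_sum, Finset.mul_sum]
        refine Finset.sum_congr rfl fun i _ => ?_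
        rw [Finset.mul_sum]
        exact Finset.sum_congr rfl fun j _ => by ring
    rw [h1, h2]
    refine Finset.sum_le_sum fun i hi => Finset.sum_le_sum fun j hj => ?_
    have hi := Finset.mem_range.1 hi
    have hj := Finset.mem_range.1 hj
    have h3 := hz i (by omega) j (by omega)
    have h4 : |a i * a j * (inner ℝ (z i) (z j) - if i = j then v else 0)| ≤ |a i| * |a j| * η := by
      rw [abs_mul, abs_mul]
      gcongr
    have h5 := (abs_le.1 h4).1
    linarith
  have hPy : ‖W.starProjection y‖ ^ 2 ≤ η * S ^ 2 := by
    have h1 : ‖W.starProjection y‖ ≤ S * √η := by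
      rw [hy, map_sum, hS, Finset.sum_mul]
      refine (norm_sum_le _ _).trans (Finset.sum_le_sum fun i hi => ?_)
      have hi := Finset.mem_range.1 hi
      rw [map_smul, norm_smul, Real.norm_eq_abs]
      gcongr
      exact Real.le_sqrt_of_sq_le (hP i (by omega))
    calc _ ≤ (S * √η) ^ 2 := by gcongr
      _ = η * S ^ 2 := by rw [mul_pow, Real.sq_sqrt hη]; ring
  have hmem : W.starProjection y + w ∈ W := W.add_mem (W.starProjection_apply_mem y) hw
  have h0 := W.starProjection_inner_eq_zero y _ hmem
  have h0' := W.starProjection_inner_eq_zero y _ (W.starProjection_apply_mem y)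
  -- Adding a vector of `W` cannot shorten the component of `y` orthogonal to `W`, so at most `‖P_W
  -- y‖²` is lost from `‖y‖²`.
  have hsplit : ‖y + w‖ ^ 2 = ‖y - W.starProjection y‖ ^ 2 + ‖W.starProjection y + w‖ ^ 2 := by
    rw [show y + w = (y - W.starProjection y) + (W.starProjection y + w) by abel,
      norm_add_sq_real, h0]
    ring
  have hpyth : ‖y‖ ^ 2 = ‖y - W.starProjection y‖ ^ 2 + ‖W.starProjection y‖ ^ 2 := by
    conv_lhs => rw [show y = (y - W.starProjection y) + W.starProjection y by abel]
    rw [norm_add_sq_real, h0']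
    ring
  have h5 : η * S ^ 2 ≤ η * ((p + 1) * ∑ i ∈ Finset.range (p + 1), a i ^ 2) := by gcongr
  nlinarith [sq_nonneg ‖W.starProjection y + w‖]

/-! ### Lagged mean functions -/

/-- The values of `f` at the times `2 p + 1 - q, …, N - q`. -/
def lagVec (p N q : ℕ) (f : ℕ → ℝ) : EuclideanSpace ℝ (Fin (N - 2 * p)) :=
  WithLp.toLp 2 fun k => f (2 * p + 1 + k - q)

/-- The span of the columns of the true and the candidate design, lagged by at most `2 p`. -/
def lagSpan (p T : ℕ) (l₀ l : RelConfig) (N : ℕ) :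
    Submodule ℝ (EuclideanSpace ℝ (Fin (N - 2 * p))) :=
  Submodule.span ℝ (Set.range fun c : Fin (2 * p + 1) × (Fin T ⊕ Fin l₀.m ⊕ Fin l.m) =>
    lagVec p N c.1 fun t =>
      Sum.elim (seasonInd T t) (Sum.elim (regimeInd l₀ N t) (regimeInd l N t)) c.2)

lemma finrank_lagSpan_le (p T : ℕ) (l₀ l : RelConfig) (N : ℕ) :
    Module.finrank ℝ (lagSpan p T l₀ l N) ≤ (2 * p + 1) * (T + (l₀.m + l.m)) := by
  refine (finrank_range_le_card _).trans (le_of_eq ?_)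
  simp

lemma lagVec_mem_lagSpan {p T : ℕ} {l₀ l : RelConfig} {N q : ℕ} (hq : q ≤ 2 * p)
    (s₀ s : Fin T → ℝ) (μ₀ : Fin l₀.m → ℝ) (μ : Fin l.m → ℝ) :
    lagVec p N q (fun t => fitted T l₀ N s₀ μ₀ t - fitted T l N s μ t) ∈ lagSpan p T l₀ l N := by
  have hcol : ∀ c : Fin T ⊕ Fin l₀.m ⊕ Fin l.m, lagVec p N q (fun t =>
      Sum.elim (seasonInd T t) (Sum.elim (regimeInd l₀ N t) (regimeInd l N t)) c)
      ∈ lagSpan p T l₀ l N := fun c =>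
    Submodule.subset_span ⟨(⟨q, by omega⟩, c), rfl⟩
  have hsum : lagVec p N q (fun t => fitted T l₀ N s₀ μ₀ t - fitted T l N s μ t)
      = ∑ c, Sum.elim (s₀ - s) (Sum.elim μ₀ (-μ)) c • lagVec p N q (fun t =>
        Sum.elim (seasonInd T t) (Sum.elim (regimeInd l₀ N t) (regimeInd l N t)) c) := by
    ext k
    simp only [lagVec, fitted, Fintype.sum_sum_type, Sum.elim_inl, Sum.elim_inr, PiLp.add_apply,
      WithLp.ofLp_sum, Finset.sum_apply, PiLp.smul_apply, smul_eq_mul, Pi.sub_apply, Pi.neg_apply,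
      sub_mul, neg_mul, Finset.sum_sub_distrib, Finset.sum_neg_distrib]
    simp only [mul_comm]
    ring
  rw [hsum]
  exact Submodule.sum_mem _ fun c _ => Submodule.smul_mem _ _ (hcol c)

/-! ### Probability of well-behaved samples -/

section Probability

variable {Ω : Type*} [MeasurableSpace Ω] {P : Measure Ω}
  {p T : ℕ} {φ : Fin p → ℝ} {σ : ℝ} {Z ε : ℤ → Ω → ℝ}

lemma obs_eq {Ω : Type*} (l₀ : RelConfig) (s : Fin T → ℝ) (μ : Fin l₀.m → ℝ) (ε : ℤ → Ω → ℝ) (N : ℕ)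
    (ω : Ω) (t : ℕ) : obs l₀ s μ ε N ω t = fitted T l₀ N s μ t + ε t ω := rfl

/-- Filtering a lag combination of the centred data by the true autoregression gives the same
combination of the noise, up to lagged mean functions. -/
lemma lagVec_lagSum_lagSum {Ω : Type*} {Z ε : ℤ → Ω → ℝ} {l₀ l : RelConfig} {N : ℕ} {ω : Ω}
    (hrec : ∀ t : ℤ, ε t ω = ∑ j : Fin p, φ j * ε (t - ((j : ℤ) + 1)) ω + Z t ω)
    (s₀ s : Fin T → ℝ) (μ₀ : Fin l₀.m → ℝ) (μ : Fin l.m → ℝ) (a : ℕ → ℝ) :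
    lagVec p N 0 (lagSum p (arCoeff φ)
        (lagSum p a fun t => obs l₀ s₀ μ₀ ε N ω t - fitted T l N s μ t))
      = ∑ j ∈ Finset.range (p + 1), a j • noiseVec p Z N j ω
        + ∑ j ∈ Finset.range (p + 1), ∑ i ∈ Finset.range (p + 1), (a j * arCoeff φ i) •
          lagVec p N (j + i) (fun t => fitted T l₀ N s₀ μ₀ t - fitted T l N s μ t) := by
  ext k
  set g : ℕ → ℝ := fun t => fitted T l₀ N s₀ μ₀ t - fitted T l N s μ t with hg
  have hobs : ∀ t, obs l₀ s₀ μ₀ ε N ω t - fitted T l N s μ t = ε t ω + g t := fun t => by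
    rw [obs_eq, hg]; ring
  have hZ : ∀ j ∈ Finset.range (p + 1), Z (2 * p + 1 + k - j) ω
      = ∑ i ∈ Finset.range (p + 1), arCoeff φ i * ε ((2 * p + 1 + k - (j + i) : ℕ)) ω :=
    fun j hj => by
      have hj := Finset.mem_range.1 hj
      have h1 := sum_range_arCoeff φ (fun i => ε (2 * p + 1 + k - j - i) ω)
      simp only [smul_eq_mul] at h1
      have h2 := hrec (2 * p + 1 + k - j)
      have h3 : ∑ i ∈ Finset.range (p + 1), arCoeff φ i * ε ((2 * p + 1 + k - (j + i) : ℕ)) ω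
          = ∑ i ∈ Finset.range (p + 1), arCoeff φ i * ε (2 * p + 1 + k - j - i) ω := by
        refine Finset.sum_congr rfl fun i hi => ?_
        have hi := Finset.mem_range.1 hi
        congr 2
        push_cast [Nat.cast_sub (show j + i ≤ 2 * p + 1 + k by omega)]
        ring
      rw [h3, h1]
      push_cast
      rw [sub_zero]
      linarith
  simp only [lagVec, noiseVec, lagSum, hobs, PiLp.add_apply, WithLp.ofLp_sum, Finset.sum_apply,
    PiLp.smul_apply, smul_eq_mul, Nat.sub_zero, Nat.sub_sub]
  have hZsum : ∑ j ∈ Finset.range (p + 1), a j * Z (2 * p + 1 + k - j) ω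
      = ∑ j ∈ Finset.range (p + 1), a j * ∑ i ∈ Finset.range (p + 1),
        arCoeff φ i * ε ((2 * p + 1 + k - (j + i) : ℕ)) ω :=
    Finset.sum_congr rfl fun j hj => by rw [hZ j hj]
  rw [hZsum]
  simp only [Finset.mul_sum, ← Finset.sum_add_distrib]
  rw [Finset.sum_comm]
  refine Finset.sum_congr rfl fun j _ => Finset.sum_congr rfl fun i _ => ?_
  rw [add_comm i j]
  ring

lemma norm_sq_lagVec (N : ℕ) (f : ℕ → ℝ) :
    ‖lagVec p N 0 f‖ ^ 2 = ∑ t ∈ Finset.Icc (2 * p + 1) N, f t ^ 2 := by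
  rw [EuclideanSpace.norm_sq_eq, ← sum_fin_sub_eq (2 * p) N (fun t => f t ^ 2)]
  simp [lagVec]

lemma measure_le_of_ae_imp {A B : Set Ω} (h : ∀ᵐ ω ∂P, ω ∈ A → ω ∈ B) : P A ≤ P B :=
  measure_mono_ae h

namespace IsCausalAR

/-- With probability tending to one, lag combinations of the centred data are nondegenerate. -/
theorem exists_tendsto_measure_not_lower [IsProbabilityMeasure P] (h : IsCausalAR P φ σ Z ε)
    (hσ : 0 < σ) (l₀ l : RelConfig) (s₀ : Fin T → ℝ) (μ₀ : Fin l₀.m → ℝ) :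
    ∃ κ : ℝ, 0 < κ ∧ Tendsto (fun N : ℕ => P {ω | ¬ ∀ (a : ℕ → ℝ) (s : Fin T → ℝ)
      (μ : Fin l.m → ℝ), κ * N * ∑ i ∈ Finset.range (p + 1), a i ^ 2 ≤
        ∑ t ∈ Finset.Icc (p + 1) N,
          lagSum p a (fun t => obs l₀ s₀ μ₀ ε N ω t - fitted T l N s μ t) t ^ 2})
      atTop (nhds 0) := by
  set C := 1 + ∑ j, |φ j| with hC
  have hCpos : 0 < C := by
    have : 0 ≤ ∑ j, |φ j| := Finset.sum_nonneg fun _ _ => abs_nonneg _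
    linarith
  have hcoef : ∀ i ≤ p, |arCoeff φ i| ≤ C := fun i hi => by
    rcases i with _ | i
    · have : 0 ≤ ∑ j, |φ j| := Finset.sum_nonneg fun _ _ => abs_nonneg _
      simp only [arCoeff, abs_one]
      linarith
    · have := Finset.single_le_sum (f := fun j => |φ j|) (fun _ _ => abs_nonneg _)
        (Finset.mem_univ (⟨i, by omega⟩ : Fin p))
      simp only [arCoeff, show i < p by omega, dif_pos, abs_neg]
      linarith
  -- This choice makes `σ² - 2 η (p + 1)` equal to `σ² / 2`. The value of `κ` below divides this by
  -- the squared gain `(p + 1)² C²` of the true filter.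
  set η := σ ^ 2 / (4 * (p + 1)) with hη
  have hηpos : 0 < η := by positivity
  refine ⟨σ ^ 2 / 2 / ((p + 1) ^ 2 * C ^ 2), by positivity, ?_⟩
  set W := lagSpan p T l₀ l with hW
  set R : Finset ℕ := Finset.range (p + 1) with hR
  have hlim : Tendsto (fun N : ℕ =>
      ∑ i ∈ R, ∑ j ∈ R, P {ω | η * N ≤ |inner ℝ (noiseVec p Z N i ω) (noiseVec p Z N j ω)
        - if i = j then σ ^ 2 * N else 0|}
      + ∑ i ∈ R, P {ω | η * N ≤ ‖(W N).starProjection (noiseVec p Z N i ω)‖ ^ 2})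
      atTop (nhds 0) := by
    have h1 := tendsto_finsetSum R fun i _ => tendsto_finsetSum R fun j _ =>
      h.tendsto_measure_gram_noiseVec i j hηpos
    have h2 := tendsto_finsetSum R fun i _ =>
      h.tendsto_measure_proj_noiseVec i hηpos W (finrank_lagSpan_le p T l₀ l)
    simpa using h1.add h2
  refine tendsto_of_tendsto_of_tendsto_of_le_of_le tendsto_const_nhds hlim
    (fun _ => zero_le) fun N => ?_
  -- Countably many times: almost surely the recursion holds at all of them together.
  have hrec := ae_all_iff.2 h.recursion
  calc P {ω | ¬ ∀ (a : ℕ → ℝ) (s : Fin T → ℝ) (μ : Fin l.m → ℝ), _}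
      ≤ P ((⋃ i ∈ R, ⋃ j ∈ R, {ω | η * N ≤ |inner ℝ (noiseVec p Z N i ω) (noiseVec p Z N j ω)
        - if i = j then σ ^ 2 * N else 0|})
      ∪ ⋃ i ∈ R, {ω | η * N ≤ ‖(W N).starProjection (noiseVec p Z N i ω)‖ ^ 2}) := by
        refine measure_le_of_ae_imp ?_
        filter_upwards [hrec] with ω hω hbad
        by_contra hgood
        apply hbad
        simp only [Set.mem_union, Set.mem_iUnion, Set.mem_ofPred_eq, not_or, not_exists,
          not_le] at hgood
        obtain ⟨hg1, hg2⟩ := hgood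
        -- The good event involves only the noise and the subspace `W N`, so the bound is uniform
        -- over all coefficients and candidate means, including data-dependent ones.
        intro a s μ
        set f : ℕ → ℝ := fun t => obs l₀ s₀ μ₀ ε N ω t - fitted T l N s μ t with hf
        have hlow := nearly_orthogonal_lower_bound (W N) (p := p) (v := σ ^ 2 * N) (η := η * N)
          (z := fun i => noiseVec p Z N i ω) (by positivity)
          (fun i hi j hj => (hg1 i (by simp [hR]; omega) j (by simp [hR]; omega)).le)
          (fun i hi => (hg2 i (by simp [hR]; omega)).le) a
          (w := ∑ j ∈ Finset.range (p + 1), ∑ i ∈ Finset.range (p + 1), (a j * arCoeff φ i) •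
            lagVec p N (j + i) (fun t => fitted T l₀ N s₀ μ₀ t - fitted T l N s μ t))
          (Submodule.sum_mem _ fun j hj => Submodule.sum_mem _ fun i hi =>
            Submodule.smul_mem _ _ (lagVec_mem_lagSpan (by
              have := Finset.mem_range.1 hi
              have := Finset.mem_range.1 hj
              omega) s₀ s μ₀ μ))
        rw [← lagVec_lagSum_lagSum hω s₀ s μ₀ μ a, norm_sq_lagVec, ← hf] at hlow
        have hup := sum_lagSum_sq_le_offset (N := N) hcoef (lagSum p a f) p
        rw [show p + p + 1 = 2 * p + 1 by ring] at hup
        have h3 := hlow.trans hup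
        have h4 : σ ^ 2 * N - 2 * (η * N) * (p + 1) = σ ^ 2 / 2 * N := by
          rw [hη]; field_simp; ring
        rw [h4] at h3
        rw [div_mul_eq_mul_div, div_mul_eq_mul_div, div_le_iff₀ (by positivity)]
        linarith
    _ ≤ _ := by
        refine (measure_union_le _ _).trans (add_le_add ?_ (measure_biUnion_finset_le _ _))
        refine (measure_biUnion_finset_le _ _).trans (Finset.sum_le_sum fun i _ => ?_)
        exact measure_biUnion_finset_le _ _

/-- The partial sums of the moving average have second moment at most `σ² (∑ |ψ j|)²`; Fatou's lemma
passes this to the almost sure limit, which also supplies measurability of the errors. -/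
lemma exists_integral_error_sq_le (h : IsCausalAR P φ σ Z ε) :
    ∃ V : ℝ, 0 ≤ V ∧ ∀ t, Integrable (fun ω => ε t ω ^ 2) P ∧ ∫ ω, ε t ω ^ 2 ∂P ≤ V := by
  obtain ⟨ψ, hψ, hsum⟩ := h.causal
  set S := ∑' j, |ψ j| with hS
  refine ⟨σ ^ 2 * S ^ 2, by positivity, fun t => ?_⟩
  set Y : ℕ → Ω → ℝ := fun n ω => ∑ j ∈ Finset.range n, ψ j * Z (t - j) ω with hY
  have hlim : ∀ᵐ ω ∂P, Tendsto (fun n => Y n ω) atTop (nhds (ε t ω)) := by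
    filter_upwards [hsum t] with ω hω using hω.tendsto_sum_nat
  have hYm : ∀ n, AEMeasurable (Y n) P := fun n =>
    Finset.aemeasurable_fun_sum _ fun j _ => (h.aemeasurable_noise _).const_mul _
  have hεm : AEMeasurable (ε t) P := aemeasurable_of_tendsto_metrizable_ae atTop hYm hlim
  have hmom := fun n => h.integral_noise_sum_sq (Finset.range n) ψ (τ := fun j : ℕ => t - j)
    (fun a b hab => by simpa using hab)
  have hYle : ∀ n, ∫⁻ ω, ENNReal.ofReal (Y n ω ^ 2) ∂P ≤ ENNReal.ofReal (σ ^ 2 * S ^ 2) :=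
    fun n => by
      rw [← ofReal_integral_eq_lintegral_ofReal (hmom n).1 (ae_of_all _ fun _ => sq_nonneg _),
        (hmom n).2]
      refine ENNReal.ofReal_le_ofReal (mul_le_mul_of_nonneg_left ?_ (sq_nonneg _))
      calc ∑ j ∈ Finset.range n, ψ j ^ 2 = ∑ j ∈ Finset.range n, |ψ j| ^ 2 := by simp
        _ ≤ (∑ j ∈ Finset.range n, |ψ j|) ^ 2 :=
          Finset.sum_sq_le_sq_sum_of_nonneg fun _ _ => abs_nonneg _
        _ ≤ S ^ 2 := by
          have : ∑ j ∈ Finset.range n, |ψ j| ≤ S :=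
            hψ.sum_le_tsum _ fun _ _ => abs_nonneg _
          gcongr
  have hle : ∫⁻ ω, ENNReal.ofReal (ε t ω ^ 2) ∂P ≤ ENNReal.ofReal (σ ^ 2 * S ^ 2) := by
    calc ∫⁻ ω, ENNReal.ofReal (ε t ω ^ 2) ∂P
        = ∫⁻ ω, liminf (fun n => ENNReal.ofReal (Y n ω ^ 2)) atTop ∂P := by
          refine lintegral_congr_ae ?_
          filter_upwards [hlim] with ω hω
          exact (ENNReal.tendsto_ofReal (hω.pow 2)).liminf_eq.symm
      _ ≤ liminf (fun n => ∫⁻ ω, ENNReal.ofReal (Y n ω ^ 2) ∂P) atTop :=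
          lintegral_liminf_le' fun n => ((hYm n).pow_const 2).ennreal_ofReal
      _ ≤ ENNReal.ofReal (σ ^ 2 * S ^ 2) :=
          liminf_le_of_frequently_le' (Frequently.of_forall hYle)
  have hInt : Integrable (fun ω => ε t ω ^ 2) P := by
    refine ⟨(hεm.pow_const 2).aestronglyMeasurable, ?_⟩
    rw [hasFiniteIntegral_iff_ofReal (ae_of_all _ fun _ => sq_nonneg _)]
    exact hle.trans_lt ENNReal.ofReal_lt_top
  refine ⟨hInt, ?_⟩
  rw [← ofReal_integral_eq_lintegral_ofReal hInt (ae_of_all _ fun _ => sq_nonneg _)] at hle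
  exact (ENNReal.ofReal_le_ofReal_iff (by positivity)).1 hle

lemma abs_fitted_le (l₀ : RelConfig) (N : ℕ) (s : Fin T → ℝ) (μ : Fin l₀.m → ℝ) (t : ℕ) :
    |fitted T l₀ N s μ t| ≤ ∑ v, |s v| + ∑ r, |μ r| := by
  refine (abs_add_le _ _).trans (add_le_add ?_ ?_)
  · refine (Finset.abs_sum_le_sum_abs _ _).trans (Finset.sum_le_sum fun v _ => ?_)
    unfold seasonInd
    split_ifs <;> simp
  · refine (Finset.abs_sum_le_sum_abs _ _).trans (Finset.sum_le_sum fun v _ => ?_)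
    unfold regimeInd
    split_ifs <;> simp

/-- The sample second moment is bounded in probability. -/
theorem exists_measure_not_upper_le [IsProbabilityMeasure P] (h : IsCausalAR P φ σ Z ε)
    (l₀ : RelConfig) (s₀ : Fin T → ℝ) (μ₀ : Fin l₀.m → ℝ) {δ : ℝ} (hδ : 0 < δ) :
    ∃ G : ℝ, 0 < G ∧ ∀ N : ℕ,
      P {ω | ¬ ∑ t ∈ Finset.Icc 1 N, obs l₀ s₀ μ₀ ε N ω t ^ 2 ≤ G * N} ≤ ENNReal.ofReal δ := by
  obtain ⟨V, hV, hmom⟩ := h.exists_integral_error_sq_le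
  set B := ∑ v, |s₀ v| + ∑ r, |μ₀ r| with hB
  have hB0 : 0 ≤ B := by positivity
  -- The `+ 1` keeps `c` positive even when `V = 0`.
  set c := (V + 1) / δ with hc
  have hcpos : 0 < c := by positivity
  refine ⟨2 * B ^ 2 + 2 * c, by positivity, fun N => ?_⟩
  rcases Nat.eq_zero_or_pos N with rfl | hN
  · simp
  have hN' : (0 : ℝ) < N := by exact_mod_cast hN
  have hInt : Integrable (fun ω => ∑ t ∈ Finset.Icc 1 N, ε t ω ^ 2) P :=
    integrable_finsetSum _ fun t _ => (hmom t).1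
  have hle : ∫ ω, ∑ t ∈ Finset.Icc 1 N, ε t ω ^ 2 ∂P ≤ N * V := by
    rw [integral_finsetSum (f := fun (t : ℕ) ω => ε t ω ^ 2) _ fun t _ => (hmom t).1]
    refine (Finset.sum_le_sum fun (t : ℕ) _ => (hmom t).2).trans (le_of_eq ?_)
    simp
  have hmarkov := mul_meas_ge_le_integral_of_nonneg
    (ae_of_all P fun ω => Finset.sum_nonneg fun (t : ℕ) (_ : t ∈ Finset.Icc 1 N) =>
      sq_nonneg (ε t ω)) hInt (c * N)
  have hsub : {ω | ¬ ∑ t ∈ Finset.Icc 1 N, obs l₀ s₀ μ₀ ε N ω t ^ 2 ≤ (2 * B ^ 2 + 2 * c) * N}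
      ⊆ {ω | c * N ≤ ∑ t ∈ Finset.Icc 1 N, ε t ω ^ 2} := fun ω hω => by
    simp only [Set.mem_ofPred_eq, not_le] at hω ⊢
    have h1 : ∑ t ∈ Finset.Icc 1 N, obs l₀ s₀ μ₀ ε N ω t ^ 2
        ≤ ∑ t ∈ Finset.Icc 1 N, (2 * B ^ 2 + 2 * ε t ω ^ 2) := by
      refine Finset.sum_le_sum fun t _ => ?_
      rw [obs_eq]
      have h2 := sq_le_sq' (abs_le.1 (abs_fitted_le l₀ N s₀ μ₀ t)).1
        (abs_le.1 (abs_fitted_le l₀ N s₀ μ₀ t)).2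
      rw [← hB] at h2
      nlinarith [sq_nonneg (fitted T l₀ N s₀ μ₀ t - ε t ω)]
    simp only [Finset.sum_add_distrib, ← Finset.mul_sum, Finset.sum_const, Nat.card_Icc,
      nsmul_eq_mul, Nat.add_sub_cancel] at h1
    linarith
  refine (measure_mono hsub).trans ?_
  rw [← ofReal_measureReal (measure_ne_top P _)]
  refine ENNReal.ofReal_le_ofReal ?_
  have h2 := hmarkov.trans hle
  have h3 : c * P.real {ω | c * N ≤ ∑ t ∈ Finset.Icc 1 N, ε t ω ^ 2} ≤ V := by
    refine le_of_mul_le_mul_left ?_ hN'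
    linarith
  have h4 : V ≤ c * δ := by rw [hc, div_mul_cancel₀ _ hδ.ne']; linarith
  exact le_of_mul_le_mul_left (h3.trans h4) hcpos

end IsCausalAR

end Probability

end Changepoint

end

/-! ### Assembly of the comparison -/

theorem theorem3
    -- AR order, period, prior hyper-parameters, class of candidate models
    (p T : ℕ) (hT : 1 ≤ T) (ν a b₁ b₂ : ℝ) (hν : 0 < ν) (ha : 0 < a) (hb₁ : 0 < b₁) (hb₂ : 0 < b₂)
    (M : ℕ) (d : ℝ) (hd : 0 < d)
    -- documented times for each sample size: either no metadata at all, or both the documented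
    -- and the undocumented times increase linearly
    (doc : ℕ → Finset ℕ)
    (hdoc : (∀ N, doc N = ∅) ∨
      (((fun N => (Changepoint.nUndoc p N (doc N) : ℝ)) =Θ[Filter.atTop] fun N : ℕ => (N : ℝ)) ∧
       ((fun N => (Changepoint.nDoc p N (doc N) : ℝ)) =Θ[Filter.atTop] fun N : ℕ => (N : ℝ)))) :
    -- the additive constant depends on `N`, not on the candidate model, the truth or the data
    ∃ c : ℕ → ℝ,
      ∀ (Ω : Type*) [MeasurableSpace Ω] (P : MeasureTheory.Measure Ω)
        [MeasureTheory.IsProbabilityMeasure P]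
        (l0 : Changepoint.RelConfig) (_ : l0 ∈ Changepoint.Lam M d)
        (s : Fin T → ℝ) (μ : Fin l0.m → ℝ) (φ : Fin p → ℝ) (σ : ℝ) (_ : 0 < σ)
        (Z ε : ℤ → Ω → ℝ) (_ : Changepoint.IsCausalAR P φ σ Z ε),
        ∀ l ∈ Changepoint.Lam M d,
          Changepoint.IsBigOPOne P fun N ω =>
            Changepoint.BMDL p T ν a b₁ b₂ (doc N) l N (Changepoint.obs l0 s μ ε N ω)
              - Changepoint.MDL p T l N (Changepoint.obs l0 s μ ε N ω) - c N := by
  have : NeZero T := ⟨by omega⟩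
  refine ⟨Changepoint.normConst p b₁ b₂ doc, ?_⟩
  intro Ω _ P _ l0 _ s μ φ σ hσ Z ε h l hl δ hδ
  -- `κ` is independent of `δ`, whereas `G` grows as `δ` shrinks: the final bound therefore holds in
  -- probability. Each way of failing to be a good sample receives probability `δ / 2`.
  obtain ⟨κ, hκ, hlower⟩ := h.exists_tendsto_measure_not_lower hσ l0 l s μ
  obtain ⟨G, hG, hupper⟩ := h.exists_measure_not_upper_le l0 s μ (half_pos hδ)
  obtain ⟨K₁, N₁, hK₁⟩ := Changepoint.goodSample_comparison (p := p) (T := T) hν hd hl hκ hG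
  obtain ⟨K₂, hK₂⟩ := Changepoint.prior_comparison ha hb₁ hb₂ hdoc l
  -- `K₁` pays for the variances, half of `K₁` for the determinant, `K₂` for the prior; the last two
  -- terms are the fixed contributions of `ν` and of `log (m + 1)`.
  refine ⟨3 / 2 * K₁ + K₂ + |(l.m : ℝ) / 2 * Real.log ν| + |Real.log ((l.m : ℝ) + 1)|, ?_⟩
  have hsmall := hlower.eventually_le_const (ENNReal.ofReal_pos.2 (half_pos hδ))
  filter_upwards [hsmall, hK₂, Filter.eventually_ge_atTop N₁] with N hN hN₂ hN₁
  have hsub : ∀ ω, 3 / 2 * K₁ + K₂ + |(l.m : ℝ) / 2 * Real.log ν| + |Real.log ((l.m : ℝ) + 1)| <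
      |Changepoint.BMDL p T ν a b₁ b₂ (doc N) l N (Changepoint.obs l0 s μ ε N ω)
        - Changepoint.MDL p T l N (Changepoint.obs l0 s μ ε N ω)
        - Changepoint.normConst p b₁ b₂ doc N| →
      ¬ Changepoint.GoodSample p T l N (Changepoint.obs l0 s μ ε N ω) κ G := fun ω hω hgood => by
    obtain ⟨h1, h2⟩ := hK₁ N hN₁ _ hgood
    refine absurd hω (not_lt.2 ?_)
    have h3 := neg_abs_le ((l.m : ℝ) / 2 * Real.log ν)
    have h4 := le_abs_self ((l.m : ℝ) / 2 * Real.log ν)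
    have h5 := neg_abs_le (Real.log ((l.m : ℝ) + 1))
    have h6 := le_abs_self (Real.log ((l.m : ℝ) + 1))
    unfold Changepoint.BMDL Changepoint.MDL
    rw [abs_le] at h1 h2 hN₂ ⊢
    constructor <;> linarith
  calc P {ω | _}
      ≤ P ({ω | ¬ ∀ (a : ℕ → ℝ) (s' : Fin T → ℝ) (μ' : Fin l.m → ℝ),
          κ * N * ∑ i ∈ Finset.range (p + 1), a i ^ 2 ≤ ∑ t ∈ Finset.Icc (p + 1) N,
            Changepoint.lagSum p a (fun t => Changepoint.obs l0 s μ ε N ω t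
              - Changepoint.fitted T l N s' μ' t) t ^ 2} ∪
        {ω | ¬ ∑ t ∈ Finset.Icc 1 N, Changepoint.obs l0 s μ ε N ω t ^ 2 ≤ G * N}) := by
        refine MeasureTheory.measure_mono fun ω hω => ?_
        by_contra hnot
        simp only [Set.mem_union, Set.mem_ofPred_eq, not_or, not_not] at hnot
        exact hsub ω hω ⟨hnot.2, hnot.1⟩
    _ ≤ ENNReal.ofReal (δ / 2) + ENNReal.ofReal (δ / 2) :=
        (MeasureTheory.measure_union_le _ _).trans (add_le_add hN (hupper N))
    _ = ENNReal.ofReal δ := by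
        rw [← ENNReal.ofReal_add (by positivity) (by positivity), add_halves]
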